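/- Let $R$ be a (commutative, totally) ordered ring, $C=R(i)$ with $i^2=-1$, and let $H$ be a Hopf $^*$-algebra over $C$ with comultiplication $\Delta(g)=g_{(1)}\otimes g_{(2)}$, counit $\epsilon$ and antipode $S$ (so $\Delta$ and $\epsilon$ are $^*$-homomorphisms and $S(S(g^*)^*)=g$). All algebras are unital $^*$-algebras over $C$. A $^*$-action of $H$ on $\mathcal A$ is a left $H$-module structure $\triangleright$ on $\mathcal A$ with $g\triangleright(ab)=(g_{(1)}\triangleright a)(g_{(2)}\triangleright b)$, $g\triangleright 1=\epsilon(g)1$ and $(g\triangleright a)^*=S(g)^*\triangleright a^*$; it is inner if there is a $^*$-homomorphism $J:H\to\mathcal A$ (a momentum map) with $g\triangleright a=J(g_{(1)})\,a\,J(S(g_{(2)}))$. A $(\mathcal B,\mathcal A)$-bimodule here is a $^*$-representation of $\mathcal B$, by adjointable operators, on a pre-Hilbert right $\mathcal A$-module $\mathcal E$, i.e. a right $\mathcal A$-module with a non-degenerate inner product $\langle\cdot,\cdot\rangle:\mathcal E\times\mathcal E\to\mathcal A$ that is $C$-linear in the second argument, satisfies $\langle x,y\rangle=\langle y,x\rangle^*$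 and $\langle x,y\cdot a\rangle=\langle x,y\rangle a$, and is completely positive: every matrix $(\langle x_i,x_j\rangle)_{i,j}\in M_n(\mathcal A)$ is mapped to a nonnegative element of $R$ by every linear functional $\omega:M_n(\mathcal A)\to C$ that satisfies $\omega(X^*X)\ge 0$ for all $X$. The bimodule is $H$-covariant if it carries a compatible action of $H$, i.e. a left $H$-module structure with $g\triangleright\langle x,y\rangle=\langle S(g_{(1)})^*\triangleright x,\,g_{(2)}\triangleright y\rangle$ and $g\triangleright(b\cdot x)=(g_{(1)}\triangleright b)\cdot(g_{(2)}\triangleright x)$. Unital $^*$-algebras form a category whose arrows from $\mathcal A$ to $\mathcal B$ are the isometric isomorphism classes of $(\mathcal B,\mathcal A)$-bimodules; composition is the internal tensor product, which is $\mathcal F\otimes_{\mathcal B}\mathcal E$ with inner product $\langle\phi\otimes x,\psi\otimes y\rangle=\langle x,\langle\phi,\psi\rangle\cdot y\rangle$ modulo its degeneracy space, and the identity of $\mathcal A$ is the class of $\mathcal A$ with $\langle a,b\rangle=a^*b$. Likewise unital $^*$-algebras with a $^*$-action of $H$ form a category, with $H$-equivariant isometric isomorphism classes of $H$-covariant bimodules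 as arrows and the diagonal action on tensor products. $\mathrm{StrPic}(\mathcal B,\mathcal A)$ and $\mathrm{StrPic}_H(\mathcal B,\mathcal A)$ denote the sets of invertible arrows from $\mathcal A$ to $\mathcal B$ in these two categories, and $\mathrm{StrPic}(\mathcal A)$ and $\mathrm{StrPic}_H(\mathcal A)$ the groups of invertible arrows from $\mathcal A$ to itself. Forgetting the action of $H$ gives maps $\mathrm{StrPic}_H(\mathcal B,\mathcal A)\to\mathrm{StrPic}(\mathcal B,\mathcal A)$ and group homomorphisms $\mathrm{StrPic}_H(\mathcal A)\to\mathrm{StrPic}(\mathcal A)$. Let $\mathrm U(H,\mathcal A)$ be the set of linear maps $\mathsf a:H\to\mathcal A$ such that, for all $g,h\in H$ and $b\in\mathcal A$: $\mathsf a(1)=1$; $\mathsf a(gh)=\mathsf a(g_{(1)})\,(g_{(2)}\triangleright\mathsf a(h))$; $(g_{(1)}\triangleright b)\,\mathsf a(g_{(2)})=\mathsf a(g_{(1)})\,(g_{(2)}\triangleright b)$; and $\mathsf a(g_{(1)})\,\mathsf a(S(g_{(2)})^*)^*=\epsilon(g)1$. It is a group under the convolution $(\mathsf a*\mathsf b)(g)=\mathsf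 a(g_{(1)})\mathsf b(g_{(2)})$. For a unitary central element $c$ of $\mathcal A$, the map $\hat c(g)=(g\triangleright c^{-1})\,c$ lies in $\mathrm U(H,\mathcal A)$, the map $c\mapsto\hat c$ is a group homomorphism, and its image is central. Let $\mathrm U_0(H,\mathcal A)$ be the quotient of $\mathrm U(H,\mathcal A)$ by this image. **Theorem.** Let $\mathcal A$ and $\mathcal B$ be unital $^*$-algebras with inner $^*$-actions of $H$, given by momentum maps $J_{\mathcal A}$ and $J_{\mathcal B}$, and suppose that $\mathrm{StrPic}(\mathcal B,\mathcal A)\neq\emptyset$. Then the map $$\mathrm{StrPic}_H(\mathcal B,\mathcal A)\longrightarrow\mathrm{StrPic}(\mathcal B,\mathcal A)$$ is surjective. Moreover, the sequence of groups $$1\longrightarrow\mathrm U_0(H,\mathcal A)\longrightarrow\mathrm{StrPic}_H(\mathcal A)\longrightarrow\mathrm{StrPic}(\mathcal A)\longrightarrow 1$$ is exact and splits via the momentum map. Here the first map is the (well-defined) homomorphism that sends the class of $\mathsf a$ to the class of the canonical bimodule $\mathcal A$ with the action $(g,x)\mapsto\mathsf a(g_{(1)})\,(g_{(2)}\triangleright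 x)$, and the splitting is a group homomorphism $\sigma:\mathrm{StrPic}(\mathcal A)\to\mathrm{StrPic}_H(\mathcal A)$, right inverse to the forgetful homomorphism, that sends the class of $\mathcal E$ to the class of $\mathcal E$ with the action $g\triangleright x=J_{\mathcal A}(g_{(1)})\cdot x\cdot J_{\mathcal A}(S(g_{(2)}))$. -/

import Mathlib

open scoped TensorProduct Coalgebra
open Coalgebra CategoryTheory

set_option linter.unusedSectionVars false
set_option linter.unusedSimpArgs false

universe v w u

noncomputable section

namespace StrongPicard

section Sweedler

variable {K : Type*} [CommRing K] {H : Type*} [AddCommGroup H] [Module K H] [Coalgebra K H]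

variable (K) in
/-- Sweedler notation: `sw K (fun a b => f a b) g` is `f(g₍₁₎, g₍₂₎)`, for a bilinear expression `f`.
By `sw_eq_sum` it does not depend on the chosen representation of `Δ(g)`. -/
def sw {M : Type*} [AddCommMonoid M] (f : H → H → M) (g : H) : M :=
  ∑ i ∈ (ℛ K g).index, f ((ℛ K g).left i) ((ℛ K g).right i)

variable {M : Type*} [AddCommGroup M] [Module K M] {N : Type*} [AddCommGroup N] [Module K N]

variable (K) in
/-- Bilinear expressions. -/
structure IsBil (f : H → H → M) : Prop where
  add_left : ∀ a b c, f (a + b) c = f a c + f b c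
  smul_left : ∀ (k : K) a b, f (k • a) b = k • f a b
  add_right : ∀ a b c, f a (b + c) = f a b + f a c
  smul_right : ∀ (k : K) a b, f a (k • b) = k • f a b

/-- The bilinear map given by a bilinear expression. -/
def IsBil.mk₂ {f : H → H → M} (hf : IsBil K f) : H →ₗ[K] H →ₗ[K] M :=
  LinearMap.mk₂ K f hf.add_left hf.smul_left hf.add_right hf.smul_right

theorem sw_eq_lift {f : H → H → M} (hf : IsBil K f) (g : H) :
    sw K f g = TensorProduct.lift hf.mk₂ (comul g) := by
  rw [← (ℛ K g).eq, map_sum]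
  simp [sw, IsBil.mk₂]

theorem sw_eq_sum {f : H → H → M} (hf : IsBil K f) {ι : Type*} (s : Finset ι) (x y : ι → H) (g : H)
    (h : comul (R := K) g = ∑ i ∈ s, x i ⊗ₜ[K] y i) :
    sw K f g = ∑ i ∈ s, f (x i) (y i) := by
  rw [sw_eq_lift hf, h, map_sum]
  simp [IsBil.mk₂]

theorem sw_add {f : H → H → M} (hf : IsBil K f) (g h : H) :
    sw K f (g + h) = sw K f g + sw K f h := by
  simp [sw_eq_lift hf]

theorem sw_smul {f : H → H → M} (hf : IsBil K f) (k : K) (g : H) :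
    sw K f (k • g) = k • sw K f g := by
  simp [sw_eq_lift hf]

theorem map_sw {P Q F : Type*} [AddCommMonoid P] [AddCommMonoid Q] [FunLike F P Q]
    [AddMonoidHomClass F P Q] (φ : F) (f : H → H → P) (g : H) :
    φ (sw K f g) = sw K (fun a b => φ (f a b)) g := by
  simp [sw, map_sum]

/-- Coassociativity for a trilinear expression. -/
theorem sw_assoc (T : H → H → H → M) (h₁ : ∀ c, IsBil K (fun a b => T a b c))
    (h₂ : ∀ a, IsBil K (fun b c => T a b c)) (g : H) :
    sw K (fun a b => sw K (fun c d => T c d b) a) g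
      = sw K (fun a b => sw K (fun c d => T a c d) b) g := by
  let L : H →ₗ[K] H →ₗ[K] H →ₗ[K] M := LinearMap.mk₂ K
    (fun a b => { toFun := fun c => T a b c
                  map_add' := fun x y => (h₂ a).add_right b x y
                  map_smul' := fun k x => (h₂ a).smul_right k b x })
    (fun a b c => LinearMap.ext fun d => (h₁ d).add_left a b c)
    (fun k a b => LinearMap.ext fun d => (h₁ d).smul_left k a b)
    (fun a b c => LinearMap.ext fun d => (h₁ d).add_right a b c)
    (fun k a b => LinearMap.ext fun d => (h₁ d).smul_right k a b)
  have := congrArg (TensorProduct.lift ((TensorProduct.uncurry (.id K) H H M).comp L))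
    (sum_tmul_tmul_eq (ℛ K g) (fun i => ℛ K ((ℛ K g).left i)) (fun i => ℛ K ((ℛ K g).right i)))
  simpa [map_sum, L, sw] using this

theorem sw_counit_left (f : H →ₗ[K] M) (g : H) :
    sw K (fun a b => counit (R := K) a • f b) g = f g := by
  have := congrArg f (sum_counit_smul (R := K) (ℛ K g))
  simpa [map_sum, sw] using this

theorem sw_counit_right (f : H →ₗ[K] M) (g : H) :
    sw K (fun a b => counit (R := K) b • f a) g = f g := by
  have := congrArg (TensorProduct.lift ((LinearMap.lsmul K M).flip.comp f))
    (sum_tmul_counit_eq (R := K) (ℛ K g))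
  rw [map_sum] at this
  simp only [TensorProduct.lift.tmul, LinearMap.comp_apply, LinearMap.flip_apply,
    LinearMap.lsmul_apply, one_smul] at this
  exact this

theorem sw_congr {M : Type*} [AddCommMonoid M] {f f' : H → H → M} (h : ∀ a b, f a b = f' a b)
    (g : H) : sw K f g = sw K f' g := by
  simp only [sw, h]

end Sweedler

/-- The ring `R(i)`, where `i ^ 2 = -1`; its `star` is complex conjugation. -/
abbrev Cx (R : Type v) [CommRing R] : Type v := QuadraticAlgebra R (-1) 0

namespace Cx

/-- The order relation `0 ≤ z` on `R(i)`: `z` lies in `R` and is nonnegative there. -/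
def Nonneg {R : Type v} [CommRing R] [LE R] (z : Cx R) : Prop := 0 ≤ z.re ∧ z.im = 0

end Cx

/-- A Hopf algebra and `*`-algebra is a Hopf `*`-algebra if `Δ` and `ε` are `*`-homomorphisms and
`S ∘ * ∘ S ∘ * = id`. -/
class IsHopfStar (K : Type*) [CommRing K] [StarRing K] (H : Type*) [Ring H] [HopfAlgebra K H]
    [StarRing H] [StarModule K H] : Prop where
  comul_star : ∀ g : H, comul (R := K) (star g) = star (comul (R := K) g)
  counit_star : ∀ g : H, counit (R := K) (star g) = star (counit (R := K) g)
  antipode_star : ∀ g : H,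
    HopfAlgebra.antipode K (star (HopfAlgebra.antipode K (star g))) = g

section Action

variable (K : Type*) [CommRing K] [StarRing K] (H : Type*) [Ring H] [HopfAlgebra K H]
  [StarRing H] [StarModule K H]

/-- A left `*`-action of the Hopf `*`-algebra `H` on the unital `*`-algebra `A`. The left
`H`-module structure `g ▷ a` is `act g a`. -/
structure StarAction (A : Type*) [Ring A] [StarRing A] [Algebra K A] where
  act : H →ₐ[K] Module.End K A
  act_mul : ∀ g a b, act g (a * b) = sw K (fun g₁ g₂ => act g₁ a * act g₂ b) g
  act_one : ∀ g, act g 1 = counit (R := K) g • (1 : A)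
  act_star : ∀ g a, star (act g a) = act (star (HopfAlgebra.antipode K g)) (star a)

variable {K H}

/-- A momentum map for the action `α`: a `*`-homomorphism `J : H → A` with
`g ▷ a = J(g₍₁₎) a J(S(g₍₂₎))`. -/
def IsMomentumMap {A : Type*} [Ring A] [StarRing A] [Algebra K A] (α : StarAction K H A)
    (J : H →⋆ₐ[K] A) : Prop :=
  ∀ g a, α.act g a = sw K (fun g₁ g₂ => J g₁ * a * J (HopfAlgebra.antipode K g₂)) g

theorem sw_mul_antipode (g : H) :
    sw K (fun a b => a * HopfAlgebra.antipode K b) g = counit (R := K) g • (1 : H) :=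
  HopfAlgebra.sum_mul_antipode_eq_smul _

theorem sw_antipode_mul (g : H) :
    sw K (fun a b => HopfAlgebra.antipode K a * b) g = counit (R := K) g • (1 : H) :=
  HopfAlgebra.sum_antipode_mul_eq_smul _

theorem sw_star [IsHopfStar K H] {M : Type*} [AddCommGroup M] [Module K M] {f : H → H → M}
    (hf : IsBil K f) (g : H) : sw K f (star g) = sw K (fun a b => f (star a) (star b)) g := by
  rw [sw_eq_sum hf (ℛ K g).index (fun i => star ((ℛ K g).left i))
    (fun i => star ((ℛ K g).right i))]
  · rfl
  · rw [IsHopfStar.comul_star, ← (ℛ K g).eq, star_sum]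
    simp

theorem sw_mul {M : Type*} [AddCommGroup M] [Module K M] {f : H → H → M}
    (hf : IsBil K f) (g h : H) :
    sw K f (g * h) = sw K (fun a b => sw K (fun c d => f (a * c) (b * d)) h) g := by
  rw [sw_eq_sum hf ((ℛ K g).index ×ˢ (ℛ K h).index)
    (fun i => (ℛ K g).left i.1 * (ℛ K h).left i.2)
    (fun i => (ℛ K g).right i.1 * (ℛ K h).right i.2)]
  · simp [sw, Finset.sum_product]
  · rw [Bialgebra.comul_mul, ← (ℛ K g).eq, ← (ℛ K h).eq, Finset.sum_mul_sum, Finset.sum_product]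
    simp

theorem sw_one {M : Type*} [AddCommGroup M] [Module K M] {f : H → H → M}
    (hf : IsBil K f) : sw K f 1 = f 1 1 := by
  rw [sw_eq_sum hf {()} (fun _ => 1) (fun _ => 1)]
  · simp
  · simp [Algebra.TensorProduct.one_def]

theorem antipode_star' [IsHopfStar K H] (g : H) : star (HopfAlgebra.antipode K (star (HopfAlgebra.antipode K g))) = g := by
  have := IsHopfStar.antipode_star (K := K) (star g)
  rw [star_star] at this
  rw [this, star_star]

theorem StarAction.act_star_apply [IsHopfStar K H] {A : Type*} [Ring A] [StarRing A] [Algebra K A]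
    (α : StarAction K H A) (g : H) (a : A) :
    star (α.act (star (HopfAlgebra.antipode K g)) a) = α.act g (star a) := by
  rw [α.act_star, antipode_star']

end Action

/-! ### Positivity -/

section Positivity

variable {R : Type v} [CommRing R] [LE R]

/-- Positive functionals on a `*`-algebra. -/
def IsPositiveFunctional {M : Type*} [Ring M] [StarRing M] [Algebra (Cx R) M]
    (ω : M →ₗ[Cx R] Cx R) : Prop :=
  ∀ a, (ω (star a * a)).Nonneg

variable (R) in
/-- Positive elements of a `*`-algebra. -/
def IsPositive {M : Type*} [Ring M] [StarRing M] [Algebra (Cx R) M] (a : M) : Prop :=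
  ∀ ω : M →ₗ[Cx R] Cx R, IsPositiveFunctional ω → (ω a).Nonneg

end Positivity

/-! ### Bimodules -/

/-- `*`-representations of `B` on pre-Hilbert right `A`-modules: `left b` is the left
multiplication by `b`, `right (op a)` the right multiplication by `a`. As `B` acts by adjointable
operators, which are right `A`-linear, the two actions commute (`Rep.left_right`). -/
structure Rep (R : Type v) [CommRing R] [LE R]
    (B : Type u) [Ring B] [StarRing B] [Algebra (Cx R) B]
    (A : Type u) [Ring A] [StarRing A] [Algebra (Cx R) A] where
  carrier : Type u
  [addCommGroup : AddCommGroup carrier]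
  [module : Module (Cx R) carrier]
  left : B →ₐ[Cx R] Module.End (Cx R) carrier
  right : Aᵐᵒᵖ →ₐ[Cx R] Module.End (Cx R) carrier
  inner : carrier → carrier →ₗ[Cx R] A
  inner_star : ∀ x y, inner x y = star (inner y x)
  inner_right : ∀ x y a, inner x (right (.op a) y) = inner x y * a
  nondegenerate : ∀ x, (∀ y, inner x y = 0) → x = 0
  inner_left : ∀ b x y, inner x (left b y) = inner (left (star b) x) y
  completely_positive : ∀ (n : ℕ) (x : Fin n → carrier),
    IsPositive R (Matrix.of fun i j => inner (x i) (x j))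

attribute [instance] Rep.addCommGroup Rep.module

section Rep

variable {R : Type v} [CommRing R] [LinearOrder R] [IsStrictOrderedRing R]
  {A : Type u} [Ring A] [StarRing A] [Algebra (Cx R) A] [StarModule (Cx R) A]
  {B : Type u} [Ring B] [StarRing B] [Algebra (Cx R) B] [StarModule (Cx R) B]
  {C : Type u} [Ring C] [StarRing C] [Algebra (Cx R) C] [StarModule (Cx R) C]
  {D : Type u} [Ring D] [StarRing D] [Algebra (Cx R) D] [StarModule (Cx R) D]
  {H : Type w} [Ring H] [HopfAlgebra (Cx R) H] [StarRing H] [StarModule (Cx R) H]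

namespace Rep

theorem inner_add_left (E : Rep R B A) (x x' y : E.carrier) :
    E.inner (x + x') y = E.inner x y + E.inner x' y := by
  rw [E.inner_star, map_add, star_add, ← E.inner_star, ← E.inner_star]

theorem inner_smul_left (E : Rep R B A) (c : Cx R) (x y : E.carrier) :
    E.inner (c • x) y = star c • E.inner x y := by
  rw [E.inner_star, map_smul, star_smul, ← E.inner_star]

theorem inner_left' (E : Rep R B A) (b : B) (x y : E.carrier) :
    E.inner (E.left b x) y = E.inner x (E.left (star b) y) := by
  rw [E.inner_left, star_star]

theorem inner_right' (E : Rep R B A) (a : A) (x y : E.carrier) :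
    E.inner (E.right (.op a) x) y = star a * E.inner x y := by
  rw [E.inner_star, E.inner_right, star_mul, ← E.inner_star]

theorem ext_inner (E : Rep R B A) {y y' : E.carrier}
    (h : ∀ x, E.inner x y = E.inner x y') : y = y' := by
  rw [← sub_eq_zero]
  refine E.nondegenerate _ fun x => ?_
  rw [E.inner_star, map_sub, h, sub_self, star_zero]

theorem left_right (E : Rep R B A) (b : B) (a : A) (x : E.carrier) :
    E.left b (E.right (.op a) x) = E.right (.op a) (E.left b x) :=
  E.ext_inner fun z => by
    rw [E.inner_left, E.inner_right, E.inner_right, E.inner_left]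

/-- Isometric isomorphisms of bimodules. Right `A`-linearity is automatic (`Iso.map_right`). -/
structure Iso (E F : Rep R B A) where
  toEquiv : E.carrier ≃ₗ[Cx R] F.carrier
  inner_map : ∀ x y, F.inner (toEquiv x) (toEquiv y) = E.inner x y
  map_left : ∀ b x, toEquiv (E.left b x) = F.left b (toEquiv x)

theorem Iso.map_right {E F : Rep R B A} (φ : E.Iso F) (a : A) (x : E.carrier) :
    φ.toEquiv (E.right (.op a) x) = F.right (.op a) (φ.toEquiv x) :=
  F.ext_inner fun z => by
    obtain ⟨z, rfl⟩ := φ.toEquiv.surjective z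
    rw [φ.inner_map, E.inner_right, F.inner_right, φ.inner_map]

def Iso.refl (E : Rep R B A) : E.Iso E := ⟨.refl _ _, fun _ _ => rfl, fun _ _ => rfl⟩

def Iso.symm {E F : Rep R B A} (φ : E.Iso F) : F.Iso E :=
  ⟨φ.toEquiv.symm, fun x y => by simp [← φ.inner_map], fun b x => by
    apply φ.toEquiv.injective; simp [φ.map_left]⟩

def Iso.trans {E F G : Rep R B A} (φ : E.Iso F) (ψ : F.Iso G) : E.Iso G :=
  ⟨φ.toEquiv.trans ψ.toEquiv, fun x y => by simp [ψ.inner_map, φ.inner_map], fun b x => by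
    simp [φ.map_left, ψ.map_left]⟩

/-- Two surjections from a common module, inducing the same inner product and compatible with the
left actions, induce an isometric isomorphism of their targets. -/
theorem exists_iso {E F : Rep R B A} {T : Type*} [AddCommGroup T] [Module (Cx R) T]
    (p : T →ₗ[Cx R] E.carrier) (q : T →ₗ[Cx R] F.carrier)
    (hp : Function.Surjective p) (hq : Function.Surjective q)
    (hpq : ∀ s t, E.inner (p s) (p t) = F.inner (q s) (q t))
    (hl : ∀ b t, ∃ t', p t' = E.left b (p t) ∧ q t' = F.left b (q t)) :
    ∃ φ : E.Iso F, ∀ t, φ.toEquiv (p t) = q t := by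
  have hk : LinearMap.ker p = LinearMap.ker q := by
    ext t
    simp only [LinearMap.mem_ker]
    constructor <;> intro h
    · refine F.nondegenerate _ fun y => ?_
      obtain ⟨s, rfl⟩ := hq y
      rw [← hpq, h, E.inner_star]; simp
    · refine E.nondegenerate _ fun y => ?_
      obtain ⟨s, rfl⟩ := hp y
      rw [hpq, h, F.inner_star]; simp
  let e := (p.quotKerEquivOfSurjective hp).symm.trans
    ((Submodule.quotEquivOfEq _ _ hk).trans (q.quotKerEquivOfSurjective hq))
  have he : ∀ t, e (p t) = q t := fun t => by
    have : (p.quotKerEquivOfSurjective hp).symm (p t) = Submodule.Quotient.mk t := by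
      rw [LinearEquiv.symm_apply_eq]; rfl
    simp only [e, LinearEquiv.trans_apply, this]
    rfl
  refine ⟨⟨e, fun x y => ?_, fun b x => ?_⟩, he⟩
  · obtain ⟨s, rfl⟩ := hp x
    obtain ⟨t, rfl⟩ := hp y
    rw [he, he, hpq]
  · obtain ⟨s, rfl⟩ := hp x
    obtain ⟨t, ht, ht'⟩ := hl b s
    rw [← ht, he, he, ht']

end Rep

section Quotient

variable {K : Type*} [CommRing K] {T : Type*} [AddCommGroup T] [Module K T]
  {X : Type*} [Ring X] [Algebra K X]

/-- The action induced on the quotient by an invariant submodule. -/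
def quotAct (N : Submodule K T) (α : X →ₐ[K] Module.End K T)
    (h : ∀ g, ∀ t ∈ N, α g t ∈ N) : X →ₐ[K] Module.End K (T ⧸ N) :=
  AlgHom.ofLinearMap
    { toFun := fun g => N.mapQ N (α g) (h g)
      map_add' := fun a b => by ext t; simp
      map_smul' := fun k a => by ext t; simp }
    (by ext t; simp) (fun a b => by ext t; simp)

@[simp]
theorem quotAct_mk (N : Submodule K T) (α : X →ₐ[K] Module.End K T)
    (h : ∀ g, ∀ t ∈ N, α g t ∈ N) (g : X) (t : T) :
    quotAct N α h g (Submodule.Quotient.mk t) = Submodule.Quotient.mk (α g t) := rfl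

end Quotient

namespace Rep

/-- Rieffel's inner product `⟨φ ⊗ x, ψ ⊗ y⟩ = ⟨x, ⟨φ, ψ⟩ · y⟩` on `F ⊗ E`. -/
def preInner (F : Rep R C B) (E : Rep R B A) :
    (F.carrier ⊗[Cx R] E.carrier) →ₛₗ[starRingEnd (Cx R)]
      (F.carrier ⊗[Cx R] E.carrier) →ₗ[Cx R] A :=
  TensorProduct.lift (LinearMap.mk₂'ₛₗ (starRingEnd (Cx R)) (starRingEnd (Cx R))
    (fun φ x => TensorProduct.lift (LinearMap.mk₂ (Cx R)
      (fun ψ y => E.inner x (E.left (F.inner φ ψ) y))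
      (by intros; simp) (by intros; simp) (by intros; simp) (by intros; simp)))
    (by intros; ext; simp [inner_add_left]) (by intros; ext; simp [inner_smul_left, starRingEnd_apply])
    (by intros; ext; simp [inner_add_left]) (by intros; ext; simp [inner_smul_left, starRingEnd_apply]))

@[simp]
theorem preInner_tmul (F : Rep R C B) (E : Rep R B A) (φ ψ : F.carrier) (x y : E.carrier) :
    preInner F E (φ ⊗ₜ x) (ψ ⊗ₜ y) = E.inner x (E.left (F.inner φ ψ) y) := rfl

/-- Induction for statements on two tensors. -/
theorem tensor_induction₂ {K M N M' N' : Type*} [CommRing K] [AddCommGroup M] [Module K M]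
    [AddCommGroup N] [Module K N] [AddCommGroup M'] [Module K M'] [AddCommGroup N'] [Module K N']
    {P : M ⊗[K] N → M' ⊗[K] N' → Prop}
    (h : ∀ a b c d, P (a ⊗ₜ b) (c ⊗ₜ d)) (h0 : ∀ t, P 0 t) (h0' : ∀ s, P s 0)
    (hl : ∀ s s' t, P s t → P s' t → P (s + s') t) (hr : ∀ s t t', P s t → P s t' → P s (t + t'))
    (s : M ⊗[K] N) (t : M' ⊗[K] N') : P s t := by
  induction s with
  | zero => exact h0 t
  | add s s' h h' => exact hl _ _ _ h h'
  | tmul a b =>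
    induction t with
    | zero => exact h0' _
    | add t t' h h' => exact hr _ _ _ h h'
    | tmul c d => exact h a b c d

variable (F : Rep R C B) (E : Rep R B A)

theorem preInner_star (s t : F.carrier ⊗[Cx R] E.carrier) :
    preInner F E s t = star (preInner F E t s) := by
  refine tensor_induction₂
    (P := fun s t => preInner F E s t = star (preInner F E t s))
    ?_ ?_ ?_ ?_ ?_ s t
  · intro a b c d
    simp only [preInner_tmul]
    rw [E.inner_star, F.inner_star, E.inner_left, E.inner_star]
  · simp
  · simp
  · intro s s' t h h'; simp [h, h']
  · intro s t t' h h'; simp [h, h']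

/-- The degeneracy space of Rieffel's inner product. -/
def radical : Submodule (Cx R) (F.carrier ⊗[Cx R] E.carrier) where
  carrier := {t | ∀ s, preInner F E s t = 0}
  add_mem' := fun {a b} ha hb s => by rw [map_add, ha, hb, add_zero]
  zero_mem' := by simp
  smul_mem' := fun c t h s => by rw [map_smul, h, smul_zero]

theorem mem_radical {t : F.carrier ⊗[Cx R] E.carrier} :
    t ∈ radical F E ↔ ∀ s, preInner F E s t = 0 := Iff.rfl

/-- The relations defining `F ⊗[B] E` lie in the degeneracy space, so the quotient of `F ⊗ E` by
its degeneracy space is also the quotient of `F ⊗[B] E` by its degeneracy space. -/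
theorem balanced_mem_radical (φ : F.carrier) (b : B) (x : E.carrier) :
    F.right (.op b) φ ⊗ₜ[Cx R] x - φ ⊗ₜ[Cx R] E.left b x ∈ radical F E := by
  rw [mem_radical]
  intro s
  induction s with
  | zero => simp
  | add s s' h h' => simp only [map_add, LinearMap.add_apply, h, h', add_zero]
  | tmul ψ y => rw [map_sub]; simp [F.inner_right]

def tensorLeft : C →ₐ[Cx R] Module.End (Cx R) (F.carrier ⊗[Cx R] E.carrier) :=
  (Module.End.rTensorAlgHom (Cx R) F.carrier E.carrier).comp F.left

def tensorRight : Aᵐᵒᵖ →ₐ[Cx R] Module.End (Cx R) (F.carrier ⊗[Cx R] E.carrier) :=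
  (Module.End.lTensorAlgHom (Cx R) E.carrier F.carrier).comp E.right

@[simp]
theorem tensorLeft_tmul (c : C) (φ : F.carrier) (x : E.carrier) :
    tensorLeft F E c (φ ⊗ₜ x) = F.left c φ ⊗ₜ x := rfl

@[simp]
theorem tensorRight_tmul (a : Aᵐᵒᵖ) (φ : F.carrier) (x : E.carrier) :
    tensorRight F E a (φ ⊗ₜ x) = φ ⊗ₜ E.right a x := rfl

theorem preInner_left (c : C) (s t : F.carrier ⊗[Cx R] E.carrier) :
    preInner F E s (tensorLeft F E c t) = preInner F E (tensorLeft F E (star c) s) t := by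
  refine tensor_induction₂
    (P := fun s t => preInner F E s (tensorLeft F E c t) = preInner F E (tensorLeft F E (star c) s) t)
    ?_ ?_ ?_ ?_ ?_ s t
  · intro φ x ψ y
    simp [F.inner_left]
  · simp
  · simp
  · intro s s' t h h'; simp [h, h']
  · intro s t t' h h'; simp [h, h']

theorem preInner_right (a : A) (s t : F.carrier ⊗[Cx R] E.carrier) :
    preInner F E s (tensorRight F E (.op a) t) = preInner F E s t * a := by
  refine tensor_induction₂
    (P := fun s t => preInner F E s (tensorRight F E (.op a) t) = preInner F E s t * a)
    ?_ ?_ ?_ ?_ ?_ s t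
  · intro φ x ψ y
    simp [left_right, E.inner_right]
  · simp
  · simp
  · intro s s' t h h'; simp [h, h', add_mul]
  · intro s t t' h h'; simp [h, h', add_mul]

/-- Finitely many tensors can be written with common left factors. -/
theorem exists_common {K M N : Type*} [CommRing K] [AddCommGroup M] [Module K M]
    [AddCommGroup N] [Module K N] (n : ℕ) (t : Fin n → M ⊗[K] N) :
    ∃ (m : ℕ) (φ : Fin m → M) (x : Fin n → Fin m → N), ∀ i, t i = ∑ k, φ k ⊗ₜ[K] x i k := by
  classical
  choose s hs using fun i => TensorProduct.exists_finset (R := K) (t i)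
  let P := Σ i, s i
  let e := Fintype.equivFin P
  refine ⟨Fintype.card P, fun k => (e.symm k).2.1.1,
    fun i k => if (e.symm k).1 = i then (e.symm k).2.1.2 else 0, fun i => ?_⟩
  rw [e.symm.sum_comp (fun p : P => p.2.1.1 ⊗ₜ[K] (if p.1 = i then p.2.1.2 else 0)),
    Fintype.sum_sigma, Finset.sum_eq_single i]
  · rw [hs i, ← Finset.sum_coe_sort]
    simp
  · intro j _ hj
    simp [hj]
  · simp

theorem nonneg_sum {ι : Type*} (s : Finset ι) (f : ι → Cx R) (h : ∀ i ∈ s, (f i).Nonneg) :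
    (∑ i ∈ s, f i).Nonneg := by
  classical
  induction s using Finset.induction_on with
  | empty => simp [Cx.Nonneg]
  | insert i s hi ih =>
    rw [Finset.sum_insert hi]
    have h1 := h i (Finset.mem_insert_self _ _)
    have h2 := ih fun j hj => h j (Finset.mem_insert_of_mem hj)
    exact ⟨by simpa using add_nonneg h1.1 h2.1, by simp [h1.2, h2.2]⟩

theorem preInner_completely_positive (n : ℕ) (t : Fin n → F.carrier ⊗[Cx R] E.carrier) :
    IsPositive R (Matrix.of fun i j => preInner F E (t i) (t j)) := by
  obtain ⟨m, φ, x, h⟩ := exists_common n t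
  intro ω hω
  let L : Matrix (Fin m) (Fin m) B →ₗ[Cx R] Matrix (Fin n) (Fin n) A :=
    { toFun := fun X => Matrix.of fun i j => ∑ k, ∑ l, E.inner (x i k) (E.left (X k l) (x j l))
      map_add' := fun X Y => by
        ext i j; simp [Finset.sum_add_distrib]
      map_smul' := fun c X => by
        ext i j; simp [Finset.smul_sum] }
  have key := F.completely_positive m φ (ω.comp L) (fun Y => by
    have : L (star Y * Y) = ∑ r, Matrix.of fun i j =>
        E.inner (∑ k, E.left (Y r k) (x i k)) (∑ l, E.left (Y r l) (x j l)) := by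
      ext i j
      have hsum : ∀ (u : Fin m → E.carrier) (y : E.carrier),
          E.inner (∑ k, u k) y = ∑ k, E.inner (u k) y := fun u y => by
        rw [E.inner_star, map_sum, star_sum]
        exact Finset.sum_congr rfl fun k _ => (E.inner_star _ _).symm
      simp only [L, LinearMap.coe_mk, AddHom.coe_mk, Matrix.of_apply, Matrix.sum_apply, hsum,
        map_sum, Matrix.mul_apply, Matrix.star_apply, map_mul, LinearMap.sum_apply,
        Module.End.mul_apply]
      rw [Finset.sum_comm_cycle]
      refine Finset.sum_congr rfl fun r _ => ?_
      refine Finset.sum_congr rfl fun k _ => Finset.sum_congr rfl fun l _ => ?_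
      rw [E.inner_left, star_star]
    rw [LinearMap.comp_apply, this, map_sum]
    exact nonneg_sum _ _ fun r _ => E.completely_positive n _ ω hω)
  convert key using 2
  simp only [LinearMap.comp_apply]
  congr 1
  ext i j
  simp only [L, h, map_sum, LinearMap.sum_apply, LinearMap.coe_mk, AddHom.coe_mk,
    Matrix.of_apply, preInner_tmul]
  exact Finset.sum_comm

/-- The inner product induced by Rieffel's inner product on the quotient. -/
def tensorInner : ((F.carrier ⊗[Cx R] E.carrier) ⧸ radical F E) →ₛₗ[starRingEnd (Cx R)]
    ((F.carrier ⊗[Cx R] E.carrier) ⧸ radical F E) →ₗ[Cx R] A :=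
  (radical F E).liftQ
    (LinearMap.mk (σ := starRingEnd (Cx R))
      ⟨fun s => (radical F E).liftQ (preInner F E s) fun _ h => h s, fun s s' => by
        refine LinearMap.ext fun t => ?_
        obtain ⟨t, rfl⟩ := Submodule.Quotient.mk_surjective _ t
        change preInner F E (s + s') t = preInner F E s t + preInner F E s' t
        simp⟩ fun c s => by
        refine LinearMap.ext fun t => ?_
        obtain ⟨t, rfl⟩ := Submodule.Quotient.mk_surjective _ t
        change preInner F E (c • s) t = starRingEnd (Cx R) c • preInner F E s t
        rw [map_smulₛₗ]
        rfl)
    fun t h => by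
      rw [LinearMap.mem_ker]
      refine LinearMap.ext fun s => ?_
      obtain ⟨s, rfl⟩ := Submodule.Quotient.mk_surjective _ s
      change preInner F E t s = 0
      rw [preInner_star, h, star_zero]

/-- The internal tensor product: the quotient of `F ⊗ E` by the degeneracy space of Rieffel's
inner product. -/
def tensor : Rep R C A where
  carrier := (F.carrier ⊗[Cx R] E.carrier) ⧸ radical F E
  left := quotAct _ (tensorLeft F E) fun c t h s => by rw [preInner_left, h]
  right := quotAct _ (tensorRight F E) fun a t h s => by
    rw [← MulOpposite.op_unop a, preInner_right, h, zero_mul]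
  inner := fun x => tensorInner F E x
  inner_star x y := by
    obtain ⟨s, rfl⟩ := Submodule.Quotient.mk_surjective _ x
    obtain ⟨t, rfl⟩ := Submodule.Quotient.mk_surjective _ y
    exact preInner_star F E s t
  inner_right x y a := by
    obtain ⟨s, rfl⟩ := Submodule.Quotient.mk_surjective _ x
    obtain ⟨t, rfl⟩ := Submodule.Quotient.mk_surjective _ y
    exact preInner_right F E a s t
  nondegenerate x h := by
    obtain ⟨t, rfl⟩ := Submodule.Quotient.mk_surjective _ x
    rw [Submodule.Quotient.mk_eq_zero]
    intro s
    rw [preInner_star]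
    exact (congrArg star (h (Submodule.Quotient.mk s))).trans (star_zero _)
  inner_left c x y := by
    obtain ⟨s, rfl⟩ := Submodule.Quotient.mk_surjective _ x
    obtain ⟨t, rfl⟩ := Submodule.Quotient.mk_surjective _ y
    exact preInner_left F E c s t
  completely_positive n x := by
    choose t ht using fun i => Submodule.Quotient.mk_surjective _ (x i)
    obtain rfl : (fun i => Submodule.Quotient.mk (t i)) = x := funext ht
    exact preInner_completely_positive F E n t

/-- The quotient map onto the internal tensor product. -/
def tensorMk : F.carrier ⊗[Cx R] E.carrier →ₗ[Cx R] (tensor F E).carrier := (radical F E).mkQ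

theorem tensorMk_surjective : Function.Surjective (tensorMk F E) := (radical F E).mkQ_surjective

@[simp]
theorem tensor_inner_mk (s t : F.carrier ⊗[Cx R] E.carrier) :
    (tensor F E).inner (tensorMk F E s) (tensorMk F E t) = preInner F E s t := rfl

@[simp]
theorem tensor_left_mk (c : C) (t : F.carrier ⊗[Cx R] E.carrier) :
    (tensor F E).left c (tensorMk F E t) = tensorMk F E (tensorLeft F E c t) := rfl

variable (A) in
/-- The canonical bimodule `A` with inner product `⟨a, b⟩ = a^* b`. -/
def unit : Rep R A A where
  carrier := A
  left := Algebra.lmul (Cx R) A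
  right := AlgHom.ofLinearMap ((LinearMap.mul (Cx R) A).flip.comp
      (MulOpposite.opLinearEquiv (Cx R)).symm.toLinearMap)
    (by ext; simp) (fun a b => by ext; simp [mul_assoc])
  inner a := LinearMap.mulLeft (Cx R) (star a)
  inner_star := by intros; simp
  inner_right := fun x y a => (mul_assoc (star x) y a).symm
  nondegenerate x h := by simpa using h 1
  inner_left := by intros; simp [mul_assoc]
  completely_positive n x := by
    rcases n with _ | n
    · intro ω hω
      have := hω 0
      rwa [show Matrix.of _ = star (0 : Matrix (Fin 0) (Fin 0) A) * 0 from Subsingleton.elim _ _]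
    intro ω hω
    have := hω (Matrix.of fun i j => if i = 0 then x j else 0)
    convert this using 2
    ext i j
    simp [Matrix.mul_apply]

/-- The identification of `A` with the canonical bimodule. -/
def ofAlg : A ≃ₗ[Cx R] (unit (R := R) A).carrier := LinearEquiv.refl (Cx R) A

theorem unit_inner (a b : A) :
    (unit (R := R) A).inner (ofAlg a) (ofAlg b) = star a * b := rfl

theorem unit_left (a b : A) : (unit (R := R) A).left a (ofAlg b) = ofAlg (a * b) := rfl

theorem unit_right (a b : A) : (unit (R := R) A).right (.op a) (ofAlg b) = ofAlg (b * a) := rfl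

end Rep

namespace Rep

/-! ### Functoriality, unit and associativity of the internal tensor product -/

variable {F F' : Rep R C B} {E E' : Rep R B A}

theorem exists_tensor_congr (φ : F.Iso F') (ψ : E.Iso E') :
    ∃ χ : (tensor F E).Iso (tensor F' E'), ∀ t, χ.toEquiv (tensorMk F E t) =
      tensorMk F' E' (TensorProduct.map φ.toEquiv.toLinearMap ψ.toEquiv.toLinearMap t) := by
  refine exists_iso (tensorMk F E) ((tensorMk F' E').comp
    (TensorProduct.map φ.toEquiv.toLinearMap ψ.toEquiv.toLinearMap)) (tensorMk_surjective F E)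
    ((tensorMk_surjective F' E').comp
      (TensorProduct.map_surjective φ.toEquiv.surjective ψ.toEquiv.surjective)) ?_ ?_
  · intro s t
    simp only [LinearMap.comp_apply, tensor_inner_mk]
    refine tensor_induction₂ (P := fun s t => preInner F E s t = preInner F' E'
      (TensorProduct.map φ.toEquiv.toLinearMap ψ.toEquiv.toLinearMap s)
      (TensorProduct.map φ.toEquiv.toLinearMap ψ.toEquiv.toLinearMap t)) ?_ ?_ ?_ ?_ ?_ s t
    · intro a x b y
      simp [φ.inner_map, ← ψ.map_left, ψ.inner_map]
    · simp
    · simp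
    · intro s s' t h h'; simp [h, h']
    · intro s t t' h h'; simp [h, h']
  · intro c t
    refine ⟨tensorLeft F E c t, rfl, ?_⟩
    simp only [LinearMap.comp_apply, tensor_left_mk]
    congr 1
    induction t with
    | zero => simp
    | add s s' h h' => simp only [map_add, h, h']
    | tmul a x => simp [φ.map_left]

/-- `b ⊗ x ↦ b · x`. -/
def unitTensorMap (E : Rep R B A) :
    (unit (R := R) B).carrier ⊗[Cx R] E.carrier →ₗ[Cx R] E.carrier :=
  TensorProduct.lift (E.left.toLinearMap.comp (ofAlg (R := R) (A := B)).symm.toLinearMap)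

@[simp]
theorem unitTensorMap_tmul (E : Rep R B A) (b : B) (x : E.carrier) :
    unitTensorMap E (ofAlg b ⊗ₜ x) = E.left b x := rfl

theorem inner_zero_left (E : Rep R B A) (y : E.carrier) : E.inner 0 y = 0 := by
  rw [E.inner_star, map_zero, star_zero]

theorem exists_unit_tensor (E : Rep R B A) :
    ∃ χ : (tensor (unit B) E).Iso E, ∀ t, χ.toEquiv (tensorMk (unit B) E t) =
      unitTensorMap E t := by
  refine exists_iso (tensorMk (unit B) E) (unitTensorMap E) (tensorMk_surjective _ E)
    (fun x => ⟨ofAlg (1 : B) ⊗ₜ x, by simp⟩) ?_ ?_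
  · intro s t
    rw [tensor_inner_mk]
    refine tensor_induction₂ (P := fun s t => preInner (unit B) E s t = E.inner
      (unitTensorMap E s) (unitTensorMap E t)) ?_ ?_ ?_ ?_ ?_ s t
    · intro a x b y
      obtain ⟨a, rfl⟩ := ofAlg.surjective a
      obtain ⟨b, rfl⟩ := ofAlg.surjective b
      rw [preInner_tmul, unit_inner, unitTensorMap_tmul, unitTensorMap_tmul, inner_left',
        map_mul, Module.End.mul_apply]
    · intro t; rw [map_zero, map_zero, inner_zero_left, LinearMap.zero_apply]
    · intro s; rw [map_zero, map_zero, map_zero]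
    · intro s s' t h h'
      rw [map_add, map_add, inner_add_left, LinearMap.add_apply, h, h']
    · intro s t t' h h'
      rw [map_add, map_add, map_add, h, h']
  · intro c t
    refine ⟨tensorLeft (unit B) E c t, rfl, ?_⟩
    induction t with
    | zero => simp
    | add s s' h h' => simp only [map_add, h, h']
    | tmul a x =>
      obtain ⟨a, rfl⟩ := ofAlg.surjective a
      rw [tensorLeft_tmul, unit_left, unitTensorMap_tmul, unitTensorMap_tmul, map_mul,
        Module.End.mul_apply]

/-- `x ⊗ a ↦ x · a`. -/
def tensorUnitMap (E : Rep R B A) :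
    E.carrier ⊗[Cx R] (unit (R := R) A).carrier →ₗ[Cx R] E.carrier :=
  TensorProduct.lift (E.right.toLinearMap.comp ((MulOpposite.opLinearEquiv (Cx R)).toLinearMap.comp
    (ofAlg (R := R) (A := A)).symm.toLinearMap)).flip

@[simp]
theorem tensorUnitMap_tmul (E : Rep R B A) (x : E.carrier) (a : A) :
    tensorUnitMap E (x ⊗ₜ ofAlg a) = E.right (.op a) x := rfl

theorem exists_tensor_unit (E : Rep R B A) :
    ∃ χ : (tensor E (unit A)).Iso E, ∀ t, χ.toEquiv (tensorMk E (unit A) t) =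
      tensorUnitMap E t := by
  refine exists_iso (tensorMk E (unit A)) (tensorUnitMap E) (tensorMk_surjective E _)
    (fun x => ⟨x ⊗ₜ ofAlg (1 : A), by simp⟩) ?_ ?_
  · intro s t
    rw [tensor_inner_mk]
    refine tensor_induction₂ (P := fun s t => preInner E (unit A) s t = E.inner
      (tensorUnitMap E s) (tensorUnitMap E t)) ?_ ?_ ?_ ?_ ?_ s t
    · intro x a y b
      obtain ⟨a, rfl⟩ := ofAlg.surjective a
      obtain ⟨b, rfl⟩ := ofAlg.surjective b
      rw [preInner_tmul, unit_left, unit_inner, tensorUnitMap_tmul, tensorUnitMap_tmul,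
        inner_right', E.inner_right]
    · intro t; rw [map_zero, map_zero, inner_zero_left, LinearMap.zero_apply]
    · intro s; rw [map_zero, map_zero, map_zero]
    · intro s s' t h h'
      rw [map_add, map_add, inner_add_left, LinearMap.add_apply, h, h']
    · intro s t t' h h'
      rw [map_add, map_add, map_add, h, h']
  · intro c t
    refine ⟨tensorLeft E (unit A) c t, rfl, ?_⟩
    induction t with
    | zero => simp
    | add s s' h h' => simp only [map_add, h, h']
    | tmul x a =>
      obtain ⟨a, rfl⟩ := ofAlg.surjective a
      exact (left_right E c a x).symm

section Assoc

variable (G : Rep R D C) (F : Rep R C B) (E : Rep R B A)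

def assocLeft : (G.carrier ⊗[Cx R] F.carrier) ⊗[Cx R] E.carrier →ₗ[Cx R]
    (tensor (tensor G F) E).carrier :=
  (tensorMk (tensor G F) E).comp ((tensorMk G F).rTensor E.carrier)

def assocRight : (G.carrier ⊗[Cx R] F.carrier) ⊗[Cx R] E.carrier →ₗ[Cx R]
    (tensor G (tensor F E)).carrier :=
  (tensorMk G (tensor F E)).comp (((tensorMk F E).lTensor G.carrier).comp
    (TensorProduct.assoc (Cx R) G.carrier F.carrier E.carrier).toLinearMap)

theorem assocLeft_tmul (γ : G.carrier) (φ : F.carrier) (x : E.carrier) :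
    assocLeft G F E ((γ ⊗ₜ φ) ⊗ₜ x) =
      tensorMk (tensor G F) E (tensorMk G F (γ ⊗ₜ φ) ⊗ₜ x) := rfl

theorem assocRight_tmul (γ : G.carrier) (φ : F.carrier) (x : E.carrier) :
    assocRight G F E ((γ ⊗ₜ φ) ⊗ₜ x) =
      tensorMk G (tensor F E) (γ ⊗ₜ tensorMk F E (φ ⊗ₜ x)) := rfl

theorem assocLeft_surjective : Function.Surjective (assocLeft G F E) :=
  (tensorMk_surjective _ E).comp (LinearMap.rTensor_surjective _ (tensorMk_surjective G F))

theorem assocRight_surjective : Function.Surjective (assocRight G F E) :=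
  (tensorMk_surjective G _).comp ((LinearMap.lTensor_surjective _ (tensorMk_surjective F E)).comp
    (LinearEquiv.surjective _))

/-- Induction for triple tensors. -/
theorem tensor_induction₃ {K M N L : Type*} [CommRing K] [AddCommGroup M] [Module K M]
    [AddCommGroup N] [Module K N] [AddCommGroup L] [Module K L]
    {P : (M ⊗[K] N) ⊗[K] L → Prop} (h : ∀ a b c, P ((a ⊗ₜ b) ⊗ₜ c)) (h0 : P 0)
    (ha : ∀ s t, P s → P t → P (s + t)) (t : (M ⊗[K] N) ⊗[K] L) : P t := by
  induction t with
  | zero => exact h0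
  | add s t hs ht => exact ha s t hs ht
  | tmul s c =>
    induction s with
    | zero => rw [TensorProduct.zero_tmul]; exact h0
    | add s t hs ht => rw [TensorProduct.add_tmul]; exact ha _ _ hs ht
    | tmul a b => exact h a b c

theorem exists_assoc :
    ∃ χ : (tensor (tensor G F) E).Iso (tensor G (tensor F E)), ∀ t,
      χ.toEquiv (assocLeft G F E t) = assocRight G F E t := by
  refine exists_iso _ _ (assocLeft_surjective G F E) (assocRight_surjective G F E) ?_ ?_
  · intro s t
    refine tensor_induction₃ (P := fun s => (tensor (tensor G F) E).inner (assocLeft G F E s)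
      (assocLeft G F E t) = (tensor G (tensor F E)).inner (assocRight G F E s)
      (assocRight G F E t)) ?_ ?_ ?_ s
    · intro γ φ x
      refine tensor_induction₃ (P := fun t => (tensor (tensor G F) E).inner
        (assocLeft G F E ((γ ⊗ₜ φ) ⊗ₜ x))
        (assocLeft G F E t) = (tensor G (tensor F E)).inner (assocRight G F E ((γ ⊗ₜ φ) ⊗ₜ x))
        (assocRight G F E t)) ?_ ?_ ?_ t
      · intro γ' φ' x'
        simp only [assocLeft_tmul, assocRight_tmul, tensor_inner_mk, preInner_tmul,
          tensor_left_mk, tensorLeft_tmul]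
      · simp
      · intro s t h h'; rw [map_add, map_add, map_add, map_add, h, h']
    · rw [map_zero, map_zero, inner_zero_left, inner_zero_left]
    · intro s s' h h'
      rw [map_add, map_add, inner_add_left, inner_add_left, h, h']
  · intro d t
    refine ⟨(tensorLeft G F d).rTensor E.carrier t, ?_, ?_⟩
    · refine tensor_induction₃ (P := fun t => assocLeft G F E
        ((tensorLeft G F d).rTensor E.carrier t) = (tensor (tensor G F) E).left d
        (assocLeft G F E t)) ?_ ?_ ?_ t
      · intro γ φ x; rfl
      · simp
      · intro s t h h'; simp only [map_add, h, h']
    · refine tensor_induction₃ (P := fun t => assocRight G F E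
        ((tensorLeft G F d).rTensor E.carrier t) = (tensor G (tensor F E)).left d
        (assocRight G F E t)) ?_ ?_ ?_ t
      · intro γ φ x; rfl
      · simp
      · intro s t h h'; simp only [map_add, h, h']

end Assoc

end Rep

/-! ### `H`-covariant bimodules -/

/-- A compatible action of `H` on a bimodule, turning it into an `H`-covariant one: a left
`H`-module structure with `g ▷ ⟨x, y⟩ = ⟨S(g₍₁₎)^* ▷ x, g₍₂₎ ▷ y⟩` and
`g ▷ (b · x) = (g₍₁₎ ▷ b) · (g₍₂₎ ▷ x)`. -/
structure HAction (β : StarAction (Cx R) H B) (α : StarAction (Cx R) H A) (E : Rep R B A) where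
  act : H →ₐ[Cx R] Module.End (Cx R) E.carrier
  act_inner : ∀ g x y, α.act g (E.inner x y) = sw (Cx R) (fun g₁ g₂ =>
    E.inner (act (star (HopfAlgebra.antipode (Cx R) g₁)) x) (act g₂ y)) g
  act_left : ∀ g b x, act g (E.left b x) =
    sw (Cx R) (fun g₁ g₂ => E.left (β.act g₁ b) (act g₂ x)) g

namespace HAction

variable {α : StarAction (Cx R) H A} {β : StarAction (Cx R) H B} {γ : StarAction (Cx R) H C}
  {δ : StarAction (Cx R) H D}

/-- The diagonal action `g ▷ (φ ⊗ x) = (g₍₁₎ ▷ φ) ⊗ (g₍₂₎ ▷ x)`. -/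
def diag {V W : Type*} [AddCommGroup V] [Module (Cx R) V] [AddCommGroup W] [Module (Cx R) W]
    (φ : H →ₐ[Cx R] Module.End (Cx R) V) (ψ : H →ₐ[Cx R] Module.End (Cx R) W) :
    H →ₐ[Cx R] Module.End (Cx R) (V ⊗[Cx R] W) :=
  (Module.endTensorEndAlgHom (R := Cx R) (S := Cx R) (A := Cx R) (M := V) (N := W)).comp
    ((Algebra.TensorProduct.map φ ψ).comp (Bialgebra.comulAlgHom (Cx R) H))

theorem diag_tmul {V W : Type*} [AddCommGroup V] [Module (Cx R) V] [AddCommGroup W]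
    [Module (Cx R) W] (φ : H →ₐ[Cx R] Module.End (Cx R) V) (ψ : H →ₐ[Cx R] Module.End (Cx R) W)
    (g : H) (x : V) (y : W) :
    diag φ ψ g (x ⊗ₜ y) = sw (Cx R) (fun a b => φ a x ⊗ₜ[Cx R] ψ b y) g := by
  simp only [diag, AlgHom.comp_apply, Bialgebra.comulAlgHom_apply]
  rw [← (ℛ (Cx R) g).eq, map_sum, map_sum, LinearMap.sum_apply]
  rfl

variable [IsHopfStar (Cx R) H]

theorem inner_act {E : Rep R B A} (e : HAction β α E) (g : H) (x y : E.carrier) :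
    E.inner x (e.act g y) =
      sw (Cx R) (fun a b => α.act b (E.inner (e.act (star a) x) y)) g := by
  rw [sw_congr (fun a b => e.act_inner b (e.act (star a) x) y),
    ← sw_assoc (fun a c d => E.inner (e.act (star (HopfAlgebra.antipode (Cx R) c))
      (e.act (star a) x)) (e.act d y))]
  · have : ∀ a b : H, sw (Cx R) (fun c d => E.inner
        (e.act (star (HopfAlgebra.antipode (Cx R) d)) (e.act (star c) x)) (e.act b y)) a =
        counit (R := Cx R) a • E.inner x (e.act b y) := by
      intro a b
      let φ : H →+ A := 
        { toFun := fun h => E.inner (e.act (star h) x) (e.act b y)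
          map_zero' := by simp [Rep.inner_zero_left]
          map_add' := by intros; simp [Rep.inner_add_left] }
      have h := map_sw (K := Cx R) φ (fun c d => c * HopfAlgebra.antipode (Cx R) d) a
      rw [sw_mul_antipode] at h
      simp only [φ, AddMonoidHom.coe_mk, ZeroHom.coe_mk, star_mul, map_mul,
        Module.End.mul_apply] at h
      rw [← h]
      simp [Rep.inner_smul_left]
    rw [sw_congr this]
    exact (sw_counit_left ((E.inner x).comp (e.act.toLinearMap.flip y)) g).symm
  · intro c
    constructor <;> intros <;> simp [Rep.inner_add_left, Rep.inner_smul_left]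
  · intro c
    constructor <;> intros <;> simp [Rep.inner_add_left, Rep.inner_smul_left]

theorem act_inner_of {E : Rep R B A} (act : H →ₐ[Cx R] Module.End (Cx R) E.carrier)
    (h : ∀ g x y, E.inner x (act g y) =
      sw (Cx R) (fun a b => α.act b (E.inner (act (star a) x) y)) g) (g : H) (x y : E.carrier) :
    α.act g (E.inner x y) = sw (Cx R) (fun g₁ g₂ =>
      E.inner (act (star (HopfAlgebra.antipode (Cx R) g₁)) x) (act g₂ y)) g := by
  rw [sw_congr (fun a b => h b (act (star (HopfAlgebra.antipode (Cx R) a)) x) y),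
    ← sw_assoc (fun a c d => α.act d (E.inner (act (star c)
      (act (star (HopfAlgebra.antipode (Cx R) a)) x)) y))]
  · have : ∀ a b : H, sw (Cx R) (fun c d => α.act b (E.inner (act (star d)
        (act (star (HopfAlgebra.antipode (Cx R) c)) x)) y)) a =
        counit (R := Cx R) a • α.act b (E.inner x y) := by
      intro a b
      let φ : H →+ A := 
        { toFun := fun h => α.act b (E.inner (act (star h) x) y)
          map_zero' := by simp [Rep.inner_zero_left]
          map_add' := by intros; simp [Rep.inner_add_left] }
      have h := map_sw (K := Cx R) φ (fun c d => HopfAlgebra.antipode (Cx R) c * d) a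
      rw [sw_antipode_mul] at h
      simp only [φ, AddMonoidHom.coe_mk, ZeroHom.coe_mk, star_mul, map_mul,
        Module.End.mul_apply] at h
      rw [← h]
      simp [Rep.inner_smul_left]
    rw [sw_congr this]
    exact (sw_counit_left (α.act.toLinearMap.flip (E.inner x y)) g).symm
  · intro c
    constructor <;> intros <;> simp [Rep.inner_add_left, Rep.inner_smul_left]
  · intro c
    constructor <;> intros <;> simp [Rep.inner_add_left, Rep.inner_smul_left]

theorem act_right {E : Rep R B A} (e : HAction β α E) (g : H) (a : A) (x : E.carrier) :
    e.act g (E.right (.op a) x) =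
      sw (Cx R) (fun g₁ g₂ => E.right (.op (α.act g₂ a)) (e.act g₁ x)) g := by
  refine E.ext_inner fun z => ?_
  rw [e.inner_act, map_sw]
  simp only [E.inner_right, α.act_mul]
  rw [← sw_assoc (fun p q r => α.act q (E.inner (e.act (star p) z) x) * α.act r a)]
  · refine sw_congr (fun p q => ?_) g
    rw [e.inner_act p z x]
    exact (map_sw (K := Cx R) (AddMonoidHom.mulRight (α.act q a)) _ p).symm
  · intro c
    constructor <;> intros <;> simp [Rep.inner_add_left, Rep.inner_smul_left, add_mul]
  · intro c
    constructor <;> intros <;> simp [add_mul, mul_add]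

end HAction

section Diag

variable {V V' V'' W W' : Type*} [AddCommGroup V] [Module (Cx R) V] [AddCommGroup W]
  [Module (Cx R) W] [AddCommGroup V'] [Module (Cx R) V'] [AddCommGroup W'] [Module (Cx R) W']
  [AddCommGroup V''] [Module (Cx R) V'']

namespace HAction

theorem map_diag (φ : H →ₐ[Cx R] Module.End (Cx R) V) (ψ : H →ₐ[Cx R] Module.End (Cx R) W)
    (φ' : H →ₐ[Cx R] Module.End (Cx R) V') (ψ' : H →ₐ[Cx R] Module.End (Cx R) W')
    (p : V →ₗ[Cx R] V') (q : W →ₗ[Cx R] W') (hp : ∀ g x, p (φ g x) = φ' g (p x))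
    (hq : ∀ g x, q (ψ g x) = ψ' g (q x)) (g : H) (t : V ⊗[Cx R] W) :
    TensorProduct.map p q (diag φ ψ g t) = diag φ' ψ' g (TensorProduct.map p q t) := by
  induction t with
  | zero => simp
  | add s t hs ht => simp only [map_add, hs, ht]
  | tmul x y =>
    rw [TensorProduct.map_tmul, diag_tmul, diag_tmul, map_sw]
    exact sw_congr (fun a b => by rw [TensorProduct.map_tmul, hp, hq]) g

theorem assoc_diag (φ : H →ₐ[Cx R] Module.End (Cx R) V) (φ' : H →ₐ[Cx R] Module.End (Cx R) V')
    (φ'' : H →ₐ[Cx R] Module.End (Cx R) V'') (g : H) (t : (V ⊗[Cx R] V') ⊗[Cx R] V'') :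
    TensorProduct.assoc (Cx R) V V' V'' (diag (diag φ φ') φ'' g t) =
      diag φ (diag φ' φ'') g (TensorProduct.assoc (Cx R) V V' V'' t) := by
  refine Rep.tensor_induction₃ (P := fun t => TensorProduct.assoc (Cx R) V V' V''
    (diag (diag φ φ') φ'' g t) =
      diag φ (diag φ' φ'') g (TensorProduct.assoc (Cx R) V V' V'' t)) ?_ ?_ ?_ t
  · intro x y z
    rw [TensorProduct.assoc_tmul, diag_tmul, diag_tmul, map_sw]
    have h₁ : ∀ a b : H, TensorProduct.assoc (Cx R) V V' V'' (diag φ φ' a (x ⊗ₜ y) ⊗ₜ φ'' b z) =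
        sw (Cx R) (fun c d => φ c x ⊗ₜ[Cx R] (φ' d y ⊗ₜ[Cx R] φ'' b z)) a := by
      intro a b
      rw [diag_tmul]
      exact map_sw (K := Cx R) ((TensorProduct.assoc (Cx R) V V' V'').toLinearMap.comp
        ((TensorProduct.mk (Cx R) (V ⊗[Cx R] V') V'').flip (φ'' b z))) _ a
    have h₂ : ∀ a b : H, φ a x ⊗ₜ[Cx R] diag φ' φ'' b (y ⊗ₜ z) =
        sw (Cx R) (fun c d => φ a x ⊗ₜ[Cx R] (φ' c y ⊗ₜ[Cx R] φ'' d z)) b := by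
      intro a b
      rw [diag_tmul]
      exact map_sw (K := Cx R) (TensorProduct.mk (Cx R) V (V' ⊗[Cx R] V'') (φ a x)) _ b
    rw [sw_congr h₁, sw_congr h₂]
    refine sw_assoc (fun a b c => φ a x ⊗ₜ[Cx R] (φ' b y ⊗ₜ[Cx R] φ'' c z)) ?_ ?_ g
    · intro c
      constructor <;> intros <;>
        simp [TensorProduct.add_tmul, TensorProduct.tmul_add, TensorProduct.smul_tmul]
    · intro c
      constructor <;> intros <;>
        simp [TensorProduct.add_tmul, TensorProduct.tmul_add, TensorProduct.smul_tmul]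
  · simp
  · intro s t hs ht; simp only [map_add, hs, ht]

end HAction

end Diag

namespace HAction

variable {α : StarAction (Cx R) H A} {β : StarAction (Cx R) H B} {γ : StarAction (Cx R) H C}
  {δ : StarAction (Cx R) H D} [IsHopfStar (Cx R) H]

theorem preInner_diag {F : Rep R C B} {E : Rep R B A} (f : HAction γ β F) (e : HAction β α E)
    (g : H) (s t : F.carrier ⊗[Cx R] E.carrier) :
    Rep.preInner F E s (diag f.act e.act g t) =
      sw (Cx R) (fun a b => α.act b (Rep.preInner F E (diag f.act e.act (star a) s) t)) g := by
  refine Rep.tensor_induction₂ (P := fun s t => Rep.preInner F E s (diag f.act e.act g t) =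
      sw (Cx R) (fun a b => α.act b (Rep.preInner F E (diag f.act e.act (star a) s) t)) g)
      ?_ ?_ ?_ ?_ ?_ s t
  · intro φ x ψ y
    have bil : ∀ r : H, IsBil (Cx R) (fun p q => α.act r (E.inner (e.act (star q) x)
        (E.left (F.inner (f.act (star p) φ) ψ) y))) := by
      intro r
      constructor <;> intros <;> simp [Rep.inner_add_left, Rep.inner_smul_left]
    have lhs : ∀ a b : H, Rep.preInner F E (φ ⊗ₜ x) (f.act a ψ ⊗ₜ e.act b y) =
        sw (Cx R) (fun c d => E.inner x (E.left (β.act d (F.inner (f.act (star c) φ) ψ))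
          (e.act b y))) a := by
      intro a b
      rw [Rep.preInner_tmul, f.inner_act]
      exact map_sw (K := Cx R) ((E.inner x).comp (E.left.toLinearMap.flip (e.act b y))) _ a
    have rhs : ∀ a b : H, α.act b (Rep.preInner F E (diag f.act e.act (star a) (φ ⊗ₜ x))
        (ψ ⊗ₜ y)) = sw (Cx R) (fun p q => α.act b (E.inner (e.act (star q) x)
          (E.left (F.inner (f.act (star p) φ) ψ) y))) a := by
      intro a b
      have hb : IsBil (Cx R) (fun p q => f.act p φ ⊗ₜ[Cx R] e.act q x) := by
        constructor <;> intros <;>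
          simp [TensorProduct.add_tmul, TensorProduct.tmul_add, TensorProduct.smul_tmul]
      rw [diag_tmul, sw_star hb]
      let Φ : F.carrier ⊗[Cx R] E.carrier →+ A :=
        { toFun := fun s => α.act b (Rep.preInner F E s (ψ ⊗ₜ y))
          map_zero' := by simp
          map_add' := by intros; simp }
      exact map_sw (K := Cx R) Φ _ a
    rw [diag_tmul, map_sw, sw_congr lhs, sw_congr rhs]
    rw [sw_assoc (fun c d b => E.inner x (E.left (β.act d (F.inner (f.act (star c) φ) ψ))
          (e.act b y))), sw_assoc (fun p q r => α.act r (E.inner (e.act (star q) x)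
        (E.left (F.inner (f.act (star p) φ) ψ) y))) bil]
    · refine sw_congr (fun a b => ?_) g
      rw [← e.inner_act, e.act_left, map_sw]
    · intro c
      constructor <;> intros <;> simp [Rep.inner_add_left, Rep.inner_smul_left]
    · intro c
      constructor <;> intros <;> simp [Rep.inner_add_left, Rep.inner_smul_left]
    · intro c
      constructor <;> intros <;> simp [Rep.inner_add_left, Rep.inner_smul_left]
  · intro t; simp [sw]
  · intro t; simp [sw]
  · intro s s' t h h'; simp only [map_add, LinearMap.add_apply, h, h', sw, Finset.sum_add_distrib]
  · intro s t t' h h'; simp only [map_add, h, h', sw, Finset.sum_add_distrib]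

theorem diag_left {F : Rep R C B} {E : Rep R B A} (f : HAction γ β F) (e : HAction β α E)
    (g : H) (c : C) (t : F.carrier ⊗[Cx R] E.carrier) :
    diag f.act e.act g (Rep.tensorLeft F E c t) =
      sw (Cx R) (fun a b => Rep.tensorLeft F E (γ.act a c) (diag f.act e.act b t)) g := by
  induction t with
  | zero => simp [sw]
  | add s t hs ht => simp only [map_add, hs, ht, sw, Finset.sum_add_distrib]
  | tmul φ x =>
    have lhs : ∀ a b : H, f.act a (F.left c φ) ⊗ₜ[Cx R] e.act b x =
        sw (Cx R) (fun p q => F.left (γ.act p c) (f.act q φ) ⊗ₜ[Cx R] e.act b x) a := by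
      intro a b
      rw [f.act_left]
      exact map_sw (K := Cx R) ((TensorProduct.mk (Cx R) _ _).flip (e.act b x)) _ a
    have rhs : ∀ a b : H, Rep.tensorLeft F E (γ.act a c) (diag f.act e.act b (φ ⊗ₜ x)) =
        sw (Cx R) (fun p q => F.left (γ.act a c) (f.act p φ) ⊗ₜ[Cx R] e.act q x) b := by
      intro a b
      rw [diag_tmul, map_sw]
      rfl
    rw [Rep.tensorLeft_tmul, diag_tmul, sw_congr lhs, sw_congr rhs]
    refine sw_assoc (fun p q r => F.left (γ.act p c) (f.act q φ) ⊗ₜ[Cx R] e.act r x) ?_ ?_ g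
    · intro c
      constructor <;> intros <;>
        simp [TensorProduct.add_tmul, TensorProduct.tmul_add, TensorProduct.smul_tmul]
    · intro c
      constructor <;> intros <;>
        simp [TensorProduct.add_tmul, TensorProduct.tmul_add, TensorProduct.smul_tmul]

/-- The action on the internal tensor product induced by the diagonal action. -/
def tensor {F : Rep R C B} {E : Rep R B A} (f : HAction γ β F) (e : HAction β α E) :
    HAction γ α (Rep.tensor F E) where
  act := quotAct _ (diag f.act e.act) fun g t h s => by
    rw [preInner_diag]
    simp [h _, sw]
  act_inner := act_inner_of _ fun g x y => by
    obtain ⟨s, rfl⟩ := Submodule.Quotient.mk_surjective _ x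
    obtain ⟨t, rfl⟩ := Submodule.Quotient.mk_surjective _ y
    exact preInner_diag f e g s t
  act_left g c x := by
    obtain ⟨t, rfl⟩ := Submodule.Quotient.mk_surjective _ x
    exact (congrArg (Rep.tensorMk F E) (diag_left f e g c t)).trans (map_sw _ _ g)

@[simp]
theorem tensor_act_mk {F : Rep R C B} {E : Rep R B A} (f : HAction γ β F) (e : HAction β α E)
    (g : H) (t : F.carrier ⊗[Cx R] E.carrier) :
    (tensor f e).act g (Rep.tensorMk F E t) = Rep.tensorMk F E (diag f.act e.act g t) := rfl

variable (α) in
/-- The canonical bimodule `A` with the given action on `A`. -/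
def unit : HAction α α (Rep.unit (R := R) A) where
  act := α.act
  act_inner g x y := (α.act_mul g (star x) y).trans <| sw_congr (fun a b =>
    congrArg (· * α.act b y) (α.act_star_apply a x).symm) g
  act_left g b x := α.act_mul g b x

theorem unit_act (g : H) (a : A) :
    (unit α).act g (Rep.ofAlg (R := R) a) = Rep.ofAlg (α.act g a) := rfl

/-- Equivariance of isometric isomorphisms. -/
def Equivariant {E F : Rep R B A} (e : HAction β α E) (f : HAction β α F) (φ : E.Iso F) : Prop :=
  ∀ g x, φ.toEquiv (e.act g x) = f.act g (φ.toEquiv x)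

theorem exists_tensor_congr {F F' : Rep R C B} {E E' : Rep R B A} {f : HAction γ β F}
    {f' : HAction γ β F'} {e : HAction β α E} {e' : HAction β α E'} {φ : F.Iso F'} {ψ : E.Iso E'}
    (hφ : Equivariant f f' φ) (hψ : Equivariant e e' ψ) :
    ∃ χ : (Rep.tensor F E).Iso (Rep.tensor F' E'), Equivariant (tensor f e) (tensor f' e') χ := by
  obtain ⟨χ, hχ⟩ := Rep.exists_tensor_congr φ ψ
  refine ⟨χ, fun g x => ?_⟩
  obtain ⟨t, rfl⟩ := Rep.tensorMk_surjective _ _ x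
  rw [hχ, tensor_act_mk, tensor_act_mk, hχ]
  exact congrArg (Rep.tensorMk F' E') (map_diag f.act e.act f'.act e'.act _ _ hφ hψ g t)

theorem exists_tensor_unit {E : Rep R B A} (e : HAction β α E) :
    ∃ χ : (Rep.tensor E (Rep.unit A)).Iso E, Equivariant (tensor e (unit α)) e χ := by
  obtain ⟨χ, hχ⟩ := Rep.exists_tensor_unit E
  refine ⟨χ, fun g x => ?_⟩
  obtain ⟨t, rfl⟩ := Rep.tensorMk_surjective _ _ x
  rw [hχ, tensor_act_mk, hχ]
  induction t with
  | zero => simp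
  | add s t hs ht => simp only [map_add, hs, ht]
  | tmul x a =>
    obtain ⟨a, rfl⟩ := Rep.ofAlg.surjective a
    rw [diag_tmul, map_sw, Rep.tensorUnitMap_tmul, e.act_right]
    rfl

theorem exists_unit_tensor {E : Rep R B A} (e : HAction β α E) :
    ∃ χ : (Rep.tensor (Rep.unit B) E).Iso E, Equivariant (tensor (unit β) e) e χ := by
  obtain ⟨χ, hχ⟩ := Rep.exists_unit_tensor E
  refine ⟨χ, fun g x => ?_⟩
  obtain ⟨t, rfl⟩ := Rep.tensorMk_surjective _ _ x
  rw [hχ, tensor_act_mk, hχ]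
  induction t with
  | zero => simp
  | add s t hs ht => simp only [map_add, hs, ht]
  | tmul b x =>
    obtain ⟨b, rfl⟩ := Rep.ofAlg.surjective b
    rw [diag_tmul, map_sw, Rep.unitTensorMap_tmul, e.act_left]
    rfl

theorem exists_assoc {G : Rep R D C} {F : Rep R C B} {E : Rep R B A} (k : HAction δ γ G)
    (f : HAction γ β F) (e : HAction β α E) :
    ∃ χ : (Rep.tensor (Rep.tensor G F) E).Iso (Rep.tensor G (Rep.tensor F E)),
      Equivariant (tensor (tensor k f) e) (tensor k (tensor f e)) χ := by
  obtain ⟨χ, hχ⟩ := Rep.exists_assoc G F E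
  refine ⟨χ, fun g x => ?_⟩
  obtain ⟨t, rfl⟩ := Rep.assocLeft_surjective _ _ _ x
  have h₁ : ∀ t, (tensor (tensor k f) e).act g (Rep.assocLeft G F E t) =
      Rep.assocLeft G F E (diag (diag k.act f.act) e.act g t) := fun t =>
    congrArg (Rep.tensorMk _ _) (map_diag
      (diag k.act f.act) e.act (tensor k f).act e.act
      (Rep.tensorMk G F) LinearMap.id (fun _ _ => rfl) (fun _ _ => rfl) g t).symm
  have h₂ : ∀ t, (tensor k (tensor f e)).act g (Rep.assocRight G F E t) =
      Rep.assocRight G F E (diag (diag k.act f.act) e.act g t) := fun t => by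
    refine congrArg (Rep.tensorMk _ _) ((map_diag
      k.act (diag f.act e.act) k.act (tensor f e).act
      LinearMap.id (Rep.tensorMk F E) (fun _ _ => rfl) (fun _ _ => rfl) g _).symm.trans ?_)
    exact congrArg (TensorProduct.map LinearMap.id (Rep.tensorMk F E))
      (assoc_diag k.act f.act e.act g t).symm
  rw [hχ, h₁, hχ, h₂]

end HAction

end Rep

/-! ### The category of `*`-algebras and bimodules, and its `H`-covariant version -/

/-- Unital `*`-algebras over `R(i)`. -/
structure StarAlg (R : Type v) [CommRing R] where
  carrier : Type u
  [ring : Ring carrier]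
  [starRing : StarRing carrier]
  [algebra : Algebra (Cx R) carrier]
  [starModule : StarModule (Cx R) carrier]

attribute [instance] StarAlg.ring StarAlg.starRing StarAlg.algebra StarAlg.starModule

/-- Unital `*`-algebras over `R(i)` with a left `*`-action of `H`. -/
structure HStarAlg (R : Type v) [CommRing R] (H : Type w) [Ring H] [HopfAlgebra (Cx R) H]
    [StarRing H] where
  alg : StarAlg.{v, u} R
  action : StarAction (Cx R) H alg.carrier

section Categories

variable {R : Type v} [CommRing R] [LinearOrder R] [IsStrictOrderedRing R]

instance Rep.setoid (B A : StarAlg.{v, u} R) : Setoid (Rep R B.carrier A.carrier) where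
  r E F := Nonempty (E.Iso F)
  iseqv := ⟨fun E => ⟨.refl E⟩, fun ⟨φ⟩ => ⟨φ.symm⟩, fun ⟨φ⟩ ⟨ψ⟩ => ⟨φ.trans ψ⟩⟩

/-- Isometric isomorphism classes of `*`-representations of `B` on pre-Hilbert right `A`-modules. -/
def BiModStr (B A : StarAlg.{v, u} R) : Type (max v (u + 1)) := Quotient (Rep.setoid B A)

/-- The class of a bimodule. -/
def BiModStr.mk {B A : StarAlg.{v, u} R} (E : Rep R B.carrier A.carrier) : BiModStr B A := ⟦E⟧

/-- Arrows from `A` to `B` are the classes of `(B, A)`-bimodules, composition is the internal tensor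
product, identities are the canonical bimodules. -/
instance : Category.{max v (u + 1)} (StarAlg.{v, u} R) where
  Hom A B := BiModStr B A
  id A := BiModStr.mk (Rep.unit A.carrier)
  comp f g := Quotient.map₂ (fun F E => Rep.tensor F E)
    (fun _ _ h _ _ h' => Nonempty.elim h fun φ => Nonempty.elim h' fun ψ =>
      ⟨(Rep.exists_tensor_congr φ ψ).choose⟩) g f
  id_comp f := by
    induction f using Quotient.inductionOn with
    | h E => exact Quotient.sound ⟨(Rep.exists_tensor_unit E).choose⟩
  comp_id f := by
    induction f using Quotient.inductionOn with
    | h E => exact Quotient.sound ⟨(Rep.exists_unit_tensor E).choose⟩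
  assoc f g h := by
    induction f using Quotient.inductionOn with
    | h E =>
      induction g using Quotient.inductionOn with
      | h F =>
        induction h using Quotient.inductionOn with
        | h G => exact Quotient.sound ⟨(Rep.exists_assoc G F E).choose.symm⟩

variable {H : Type w} [Ring H] [HopfAlgebra (Cx R) H] [StarRing H] [StarModule (Cx R) H]

/-- `H`-covariant `*`-representations of `B` on pre-Hilbert right `A`-modules. -/
structure HRep (B A : HStarAlg.{v, w, u} R H) where
  rep : Rep R B.alg.carrier A.alg.carrier
  action : HAction B.action A.action rep

/-- `H`-equivariant isometric isomorphisms. -/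
def HRep.Iso {B A : HStarAlg.{v, w, u} R H} (E F : HRep B A) : Prop :=
  ∃ φ : E.rep.Iso F.rep, HAction.Equivariant E.action F.action φ

instance HRep.setoid (B A : HStarAlg.{v, w, u} R H) : Setoid (HRep B A) where
  r := HRep.Iso
  iseqv := ⟨fun E => ⟨.refl _, fun _ _ => rfl⟩,
    fun {E F} ⟨φ, h⟩ => ⟨φ.symm, fun g x => φ.toEquiv.injective <| by
      rw [h]; simp [Rep.Iso.symm]⟩,
    fun ⟨φ, h⟩ ⟨ψ, h'⟩ => ⟨φ.trans ψ, fun g x =>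
      (congrArg ψ.toEquiv (h g x)).trans (h' g (φ.toEquiv x))⟩⟩

/-- Isometric isomorphism classes of `H`-covariant `*`-representations of `B` on pre-Hilbert right
`A`-modules. -/
def BiModStrH (B A : HStarAlg.{v, w, u} R H) : Type (max v w (u + 1)) := Quotient (HRep.setoid B A)

/-- The class of an `H`-covariant bimodule. -/
def BiModStrH.mk {B A : HStarAlg.{v, w, u} R H} (E : HRep B A) : BiModStrH B A := ⟦E⟧

variable [IsHopfStar (Cx R) H]

/-- The internal tensor product of `H`-covariant bimodules. -/
def HRep.tensor {C B A : HStarAlg.{v, w, u} R H} (F : HRep C B) (E : HRep B A) : HRep C A :=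
  ⟨Rep.tensor F.rep E.rep, HAction.tensor F.action E.action⟩

/-- The canonical `H`-covariant bimodule. -/
def HRep.unit (A : HStarAlg.{v, w, u} R H) : HRep A A :=
  ⟨Rep.unit A.alg.carrier, HAction.unit A.action⟩

/-- The `H`-covariant version of the category of bimodules. -/
instance : Category.{max v w (u + 1)} (HStarAlg.{v, w, u} R H) where
  Hom A B := BiModStrH B A
  id A := BiModStrH.mk (HRep.unit A)
  comp f g := Quotient.map₂ (fun F E => HRep.tensor F E)
    (fun _ _ h _ _ h' => Exists.elim h fun _ hφ => Exists.elim h' fun _ hψ =>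
      HAction.exists_tensor_congr hφ hψ) g f
  id_comp f := by
    induction f using Quotient.inductionOn with
    | h E => exact Quotient.sound (HAction.exists_tensor_unit E.action)
  comp_id f := by
    induction f using Quotient.inductionOn with
    | h E => exact Quotient.sound (HAction.exists_unit_tensor E.action)
  assoc f g h := by
    induction f using Quotient.inductionOn with
    | h E =>
      induction g using Quotient.inductionOn with
      | h F =>
        induction h using Quotient.inductionOn with
        | h G => exact Quotient.sound (Setoid.symm
          (HAction.exists_assoc G.action F.action E.action))

variable (R H) in
/-- The functor forgetting the actions of `H`. -/
def forgetH : HStarAlg.{v, w, u} R H ⥤ StarAlg.{v, u} R where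
  obj A := A.alg
  map f := Quotient.map HRep.rep (fun _ _ h => Exists.elim h fun φ _ => ⟨φ⟩) f
  map_id _ := rfl
  map_comp f g := by
    induction f using Quotient.inductionOn with
    | h E =>
      induction g using Quotient.inductionOn with
      | h F => rfl

/-- The arrows from `A` to `B` of the strong Picard groupoid. -/
abbrev StrPic (B A : StarAlg.{v, u} R) : Type (max v (u + 1)) := A ≅ B

/-- The arrows from `A` to `B` of the `H`-covariant strong Picard groupoid. -/
abbrev StrPicH (B A : HStarAlg.{v, w, u} R H) : Type (max v w (u + 1)) := A ≅ B

/-- The strong Picard group; the product is given by the internal tensor product. -/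
abbrev StrPicGroup (A : StarAlg.{v, u} R) : Type (max v (u + 1)) := Aut A

/-- The `H`-covariant strong Picard group. -/
abbrev StrPicHGroup (A : HStarAlg.{v, w, u} R H) : Type (max v w (u + 1)) := Aut A

/-- The groupoid morphism forgetting the actions of `H`. -/
def StrPicH.forget (B A : HStarAlg.{v, w, u} R H) : StrPicH B A → StrPic B.alg A.alg :=
  (forgetH R H).mapIso

/-- The groupoid morphism forgetting the action of `H`, on isotropy groups. -/
def StrPicHGroup.forget (A : HStarAlg.{v, w, u} R H) : StrPicHGroup A →* StrPicGroup A.alg :=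
  (forgetH R H).mapAut A

end Categories

/-! ### The groups `U(H, A)` and `U₀(H, A)` -/

section Unitary

variable {K : Type*} [CommRing K] [StarRing K] {H : Type*} [Ring H] [HopfAlgebra K H]
  [StarRing H] [StarModule K H]

theorem sw_antipode {M : Type*} [AddCommGroup M] [Module K M] {f : H → H → M} (hf : IsBil K f)
    (g : H) : sw K f (HopfAlgebra.antipode K g) =
      sw K (fun a b => f (HopfAlgebra.antipode K b) (HopfAlgebra.antipode K a)) g := by
  have bilS : IsBil K (fun a b : H =>
      HopfAlgebra.antipode K b ⊗ₜ[K] HopfAlgebra.antipode K a) := by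
    constructor <;> intros <;>
      simp [TensorProduct.add_tmul, TensorProduct.tmul_add, TensorProduct.smul_tmul]
  have bil₁ : ∀ c d : H, IsBil K (fun u v : H => (HopfAlgebra.antipode K d * u) ⊗ₜ[K]
      (HopfAlgebra.antipode K c * v)) := by
    intro c d
    constructor <;> intros <;>
      simp [TensorProduct.add_tmul, TensorProduct.tmul_add, TensorProduct.smul_tmul, mul_add]
  let G : H →ₗ[K] H ⊗[K] H := TensorProduct.lift bilS.mk₂ ∘ₗ comul
  have hG : ∀ g, G g = sw K (fun a b : H =>
      HopfAlgebra.antipode K b ⊗ₜ[K] HopfAlgebra.antipode K a) g := fun g =>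
    (sw_eq_lift bilS g).symm
  have key : WithConv.toConv G * WithConv.toConv (comul (R := K) (A := H)) = 1 := by
    ext g
    rw [(ℛ K g).convMul_apply, LinearMap.convOne_apply]
    change sw K (fun p q => G p * comul (R := K) q) g = _
    have h₁ : ∀ p q : H, G p * comul (R := K) q = sw K (fun c d => sw K (fun u v =>
        (HopfAlgebra.antipode K d * u) ⊗ₜ[K] (HopfAlgebra.antipode K c * v)) q) p := by
      intro p q
      rw [hG, ← (ℛ K q).eq]
      simp only [sw, Finset.sum_mul, Finset.mul_sum, Algebra.TensorProduct.tmul_mul_tmul]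
      exact Finset.sum_comm
    have h₂ : ∀ c r : H, sw K (fun d q => sw K (fun u v =>
        (HopfAlgebra.antipode K d * u) ⊗ₜ[K] (HopfAlgebra.antipode K c * v)) q) r =
        (1 : H) ⊗ₜ[K] (HopfAlgebra.antipode K c * r) := by
      intro c r
      rw [← sw_assoc (fun d u v => (HopfAlgebra.antipode K d * u) ⊗ₜ[K]
        (HopfAlgebra.antipode K c * v))]
      · have : ∀ a b : H, sw K (fun d u => (HopfAlgebra.antipode K d * u) ⊗ₜ[K]
            (HopfAlgebra.antipode K c * b)) a =
            counit (R := K) a • ((1 : H) ⊗ₜ[K] (HopfAlgebra.antipode K c * b)) := by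
          intro a b
          have := map_sw (K := K) ((TensorProduct.mk K H H).flip (HopfAlgebra.antipode K c * b))
            (fun d u => HopfAlgebra.antipode K d * u) a
          rw [sw_antipode_mul] at this
          simpa [TensorProduct.smul_tmul'] using this.symm
        rw [sw_congr this]
        exact sw_counit_left ((TensorProduct.mk K H H 1).comp
          (LinearMap.mulLeft K (HopfAlgebra.antipode K c))) r
      · intro v
        constructor <;> intros <;>
          simp [TensorProduct.add_tmul, TensorProduct.smul_tmul', mul_add, add_mul]
      · intro d; exact bil₁ c d
    have h₃ := map_sw (K := K) (TensorProduct.mk K H H 1)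
      (fun c r => HopfAlgebra.antipode K c * r) g
    rw [sw_antipode_mul] at h₃
    rw [sw_congr h₁, sw_assoc (fun c d q => sw K (fun u v =>
        (HopfAlgebra.antipode K d * u) ⊗ₜ[K] (HopfAlgebra.antipode K c * v)) q), sw_congr h₂]
    · refine h₃.symm.trans ?_
      simp [Algebra.algebraMap_eq_smul_one, Algebra.TensorProduct.one_def]
    · intro q
      constructor <;> intros <;> simp [sw, TensorProduct.add_tmul, TensorProduct.smul_tmul',
        TensorProduct.tmul_add, add_mul, Finset.sum_add_distrib, Finset.smul_sum]
    · intro c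
      refine ⟨?_, ?_, fun d a b => sw_add (bil₁ c d) a b, fun k d a => sw_smul (bil₁ c d) k a⟩ <;>
      intros <;> simp [sw, TensorProduct.add_tmul, TensorProduct.smul_tmul',
        TensorProduct.tmul_add, add_mul, Finset.sum_add_distrib, Finset.smul_sum]
  have h := left_inv_eq_right_inv key LinearMap.comul_right_inv
  have h' : comul (R := K) (HopfAlgebra.antipode K g) = G g :=
    (LinearMap.congr_fun (WithConv.toConv_injective h) g).symm
  rw [hG] at h'
  exact sw_eq_sum hf _ (fun i => HopfAlgebra.antipode K ((ℛ K g).right i))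
    (fun i => HopfAlgebra.antipode K ((ℛ K g).left i)) _ h'

variable {A : Type*} [Ring A] [StarRing A] [Algebra K A] [StarModule K A]

/-- The elements of `GL(H, A)`. -/
structure IsGL (α : StarAction K H A) (a : H →ₗ[K] A) : Prop where
  map_one : a 1 = 1
  map_mul : ∀ g h, a (g * h) = sw K (fun g₁ g₂ => a g₁ * α.act g₂ (a h)) g
  comm : ∀ g b, sw K (fun g₁ g₂ => α.act g₁ b * a g₂) g = sw K (fun g₁ g₂ => a g₁ * α.act g₂ b) g

/-- The elements of `U(H, A)`. -/
structure IsU (α : StarAction K H A) (a : H →ₗ[K] A) : Prop extends IsGL α a where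
  unitary : ∀ g, sw K (fun g₁ g₂ => a g₁ * star (a (star (HopfAlgebra.antipode K g₂)))) g =
    counit (R := K) g • (1 : A)

/-- The group `U(H, A)`. -/
def UGroup (α : StarAction K H A) : Type _ := {a : H →ₗ[K] A // IsU α a}

open WithConv

/-- The map `g ↦ g ▷ b`, in the convolution algebra. -/
def orbit (α : StarAction K H A) (b : A) : WithConv (H →ₗ[K] A) := toConv (α.act.toLinearMap.flip b)

/-- The map `g ↦ a(S(g)^*)^*`. -/
def dagger (a : WithConv (H →ₗ[K] A)) : WithConv (H →ₗ[K] A) :=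
  toConv { toFun := fun g => star (a (star (HopfAlgebra.antipode K g)))
           map_add' := by simp
           map_smul' := by simp }

/-- The map `g ↦ a(g h)`. -/
def transl (a : WithConv (H →ₗ[K] A)) (h : H) : WithConv (H →ₗ[K] A) :=
  toConv (a.ofConv ∘ₗ LinearMap.mulRight K h)

theorem conv_apply (a b : WithConv (H →ₗ[K] A)) (g : H) :
    (a * b) g = sw K (fun p q => a p * b q) g := (ℛ K g).convMul_apply a b

theorem conv_bil (a b : WithConv (H →ₗ[K] A)) : IsBil K (fun p q => a p * b q) := by
  constructor <;> intros <;> simp [add_mul, mul_add]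

theorem orbit_mul (α : StarAction K H A) (b c : A) : orbit α (b * c) = orbit α b * orbit α c := by
  ext g
  exact (α.act_mul g b c).trans (conv_apply (orbit α b) (orbit α c) g).symm

theorem orbit_one (α : StarAction K H A) : orbit α 1 = 1 := by
  ext g
  exact (α.act_one g).trans (Algebra.algebraMap_eq_smul_one _).symm

theorem isU_iff (α : StarAction K H A) (a : WithConv (H →ₗ[K] A)) :
    IsU α a.ofConv ↔ a 1 = 1 ∧ (∀ h, transl a h = a * orbit α (a h)) ∧
      (∀ b, orbit α b * a = a * orbit α b) ∧ a * dagger a = 1 := by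
  constructor
  · intro h
    refine ⟨h.map_one, fun k => ?_, fun b => ?_, ?_⟩
    · ext g; exact (h.map_mul g k).trans (conv_apply a (orbit α (a k)) g).symm
    · ext g
      exact (conv_apply _ _ g).trans ((h.comm g b).trans (conv_apply a (orbit α b) g).symm)
    · ext g
      exact (conv_apply _ _ g).trans ((h.unitary g).trans (Algebra.algebraMap_eq_smul_one _).symm)
  · rintro ⟨h₁, h₂, h₃, h₄⟩
    refine ⟨⟨h₁, fun g k => ?_, fun g b => ?_⟩, fun g => ?_⟩
    · exact (congrArg (fun c : WithConv (H →ₗ[K] A) => c g) (h₂ k)).trans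
        (conv_apply a (orbit α (a k)) g)
    · exact (conv_apply (orbit α b) a g).symm.trans
        ((congrArg (fun c : WithConv (H →ₗ[K] A) => c g) (h₃ b)).trans (conv_apply _ _ g))
    · exact (conv_apply a (dagger a) g).symm.trans
        ((congrArg (fun c : WithConv (H →ₗ[K] A) => c g) h₄).trans
          (Algebra.algebraMap_eq_smul_one _))

variable [IsHopfStar K H]

theorem dagger_mul (a b : WithConv (H →ₗ[K] A)) : dagger (a * b) = dagger b * dagger a := by
  ext g
  refine Eq.trans ?_ (conv_apply (dagger b) (dagger a) g).symm
  change star ((a * b) (star (HopfAlgebra.antipode K g))) = sw K (fun p q =>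
    star (b (star (HopfAlgebra.antipode K p))) * star (a (star (HopfAlgebra.antipode K q)))) g
  rw [conv_apply, sw_star (conv_bil a b)]
  have bil : IsBil K (fun p q => star (a (star p) * b (star q))) := by
    constructor <;> intros <;> simp [add_mul, mul_add]
  refine (map_sw (K := K) (starAddEquiv (R := A)) _ _).trans ?_
  refine (sw_antipode bil g).trans ?_
  simp only [star_mul]

theorem dagger_dagger (a : WithConv (H →ₗ[K] A)) : dagger (dagger a) = a := by
  ext g
  change star (star (a (star (HopfAlgebra.antipode K (star (HopfAlgebra.antipode K g)))))) = a g
  rw [star_star, antipode_star']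

theorem dagger_one : dagger (1 : WithConv (H →ₗ[K] A)) = 1 := by
  have := dagger_mul (1 : WithConv (H →ₗ[K] A)) (dagger 1)
  rwa [one_mul, dagger_dagger, one_mul, eq_comm] at this

theorem transl_mul (a b : WithConv (H →ₗ[K] A)) (h : H) :
    transl (a * b) h = sw K (fun p q => transl a p * transl b q) h := by
  ext g
  change (a * b) (g * h) = (sw K (fun p q => transl a p * transl b q) h) g
  rw [conv_apply, sw_mul (conv_bil a b)]
  let ev : WithConv (H →ₗ[K] A) →+ A :=
    { toFun := fun c => c g, map_zero' := rfl, map_add' := fun _ _ => rfl }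
  refine Eq.trans ?_ (map_sw (K := K) ev _ h).symm
  simp only [sw]
  rw [Finset.sum_comm]
  refine Finset.sum_congr rfl fun i _ => ?_
  exact (conv_apply (transl a ((ℛ K h).left i)) (transl b ((ℛ K h).right i)) g).symm

/-- Algebra homomorphisms are convolution invertible. -/
theorem algHom_conv {X : Type*} [Ring X] [Algebra K X] (f : H →ₐ[K] X) :
    toConv f.toLinearMap * toConv (f.toLinearMap ∘ₗ HopfAlgebra.antipode K) = 1 ∧
    toConv (f.toLinearMap ∘ₗ HopfAlgebra.antipode K) * toConv f.toLinearMap = 1 := by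
  constructor
  · ext g
    rw [(ℛ K g).convMul_apply]
    simpa [map_sum, map_mul, Algebra.algebraMap_eq_smul_one, sw] using
      congrArg f (sw_mul_antipode (K := K) g)
  · ext g
    rw [(ℛ K g).convMul_apply]
    simpa [map_sum, map_mul, Algebra.algebraMap_eq_smul_one, sw] using
      congrArg f (sw_antipode_mul (K := K) g)

/-- Left multiplications, as a homomorphism of convolution algebras. -/
def lconv (a : WithConv (H →ₗ[K] A)) : WithConv (H →ₗ[K] Module.End K A) :=
  toConv ((Algebra.lmul K A).toLinearMap ∘ₗ a.ofConv)

theorem lconv_mul (a b : WithConv (H →ₗ[K] A)) : lconv (a * b) = lconv a * lconv b := by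
  apply WithConv.ext
  exact LinearMap.algHom_comp_convMul_distrib (Algebra.lmul K A) a b

theorem lconv_one : lconv (1 : WithConv (H →ₗ[K] A)) = 1 := by
  ext g x
  simp [lconv, Algebra.algebraMap_eq_smul_one]

theorem lconv_injective : Function.Injective (lconv : WithConv (H →ₗ[K] A) → _) := by
  intro a b h
  ext g
  have := LinearMap.congr_fun (congrArg (fun c : WithConv (H →ₗ[K] Module.End K A) => c g) h) 1
  simpa [lconv] using this

theorem isGL_left_inv {α : StarAction K H A} {a b : WithConv (H →ₗ[K] A)} (h₁ : a 1 = 1)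
    (h₂ : ∀ h, transl a h = a * orbit α (a h)) (hab : a * b = 1) : b * a = 1 := by
  let ρ : WithConv (H →ₗ[K] Module.End K A) := toConv α.act.toLinearMap
  let σ := lconv a * ρ
  have hσ : ∀ g x, σ g x = sw K (fun p q => a p * α.act q x) g := by
    intro g x
    rw [(ℛ K g).convMul_apply, LinearMap.sum_apply]
    rfl
  have hbil : ∀ x, IsBil K (fun p q => a p * α.act q x) := fun x => by
    constructor <;> intros <;> simp [add_mul, mul_add]
  let f : H →ₐ[K] Module.End K A := AlgHom.ofLinearMap σ.ofConv (by
      ext x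
      change σ 1 x = x
      rw [hσ, sw_one (hbil x), h₁, map_one]
      simp) (fun g h => by
      ext x
      change σ (g * h) x = σ g (σ h x)
      rw [hσ, hσ h x, sw_mul (hbil x)]
      have e₁ : ∀ p q : H, sw K (fun c d => a (p * c) * α.act (q * d) x) h =
          sw K (fun c d => (a * orbit α (a c)) p * α.act q (α.act d x)) h := by
        intro p q
        refine sw_congr (fun c d => ?_) h
        rw [← h₂ c, map_mul α.act q d]
        rfl
      rw [sw_congr e₁]
      rw [map_sw]
      simp only [sw]
      rw [Finset.sum_comm]
      refine Finset.sum_congr rfl fun i _ => ?_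
      change sw K (fun p q => (a * orbit α (a ((ℛ K h).left i))) p *
        α.act q (α.act ((ℛ K h).right i) x)) g =
          σ g (a ((ℛ K h).left i) * α.act ((ℛ K h).right i) x)
      rw [hσ]
      have e₂ := conv_apply (a * orbit α (a ((ℛ K h).left i)))
        (orbit α (α.act ((ℛ K h).right i) x)) g
      refine e₂.symm.trans ?_
      rw [mul_assoc, ← orbit_mul, conv_apply]
      rfl)
  have hf := algHom_conv f
  have hρ := algHom_conv α.act
  have hσ' : toConv f.toLinearMap = lconv a * ρ := rfl
  rw [hσ'] at hf
  have hl : (ρ * toConv (f.toLinearMap ∘ₗ HopfAlgebra.antipode K)) * lconv a = 1 := by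
    have h1 : lconv a = (lconv a * ρ) * toConv (α.act.toLinearMap ∘ₗ HopfAlgebra.antipode K) := by
      rw [mul_assoc, hρ.1, mul_one]
    rw [h1, mul_assoc, ← mul_assoc (toConv _) (lconv a * ρ), hf.2, one_mul, hρ.1]
  have hr : lconv a * lconv b = 1 := by rw [← lconv_mul, hab, lconv_one]
  have := left_inv_eq_right_inv hl hr
  apply lconv_injective
  rw [lconv_mul, lconv_one, ← this, hl]

namespace UGroup

variable {α : StarAction K H A}

theorem isU_mul {a b : WithConv (H →ₗ[K] A)} (ha : IsU α a.ofConv) (hb : IsU α b.ofConv) :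
    IsU α (a * b).ofConv := by
  rw [isU_iff] at *
  obtain ⟨a₁, a₂, a₃, a₄⟩ := ha
  obtain ⟨b₁, b₂, b₃, b₄⟩ := hb
  refine ⟨?_, fun h => ?_, fun c => ?_, ?_⟩
  · rw [conv_apply, sw_one (conv_bil a b), a₁, b₁, one_mul]
  · rw [transl_mul]
    have : ∀ p q, transl a p * transl b q = a * b * orbit α (a p * b q) := by
      intro p q
      rw [a₂, b₂, orbit_mul, mul_assoc, ← mul_assoc (orbit α _) b, b₃]
      simp only [mul_assoc]
    rw [sw_congr this, conv_apply a b h]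
    let φ : A →+ WithConv (H →ₗ[K] A) :=
      { toFun := fun c => a * b * orbit α c
        map_zero' := by
          rw [show orbit α (0 : A) = 0 by ext; simp [orbit], mul_zero]
        map_add' := fun x y => by
          rw [show orbit α (x + y) = orbit α x + orbit α y by ext; simp [orbit], mul_add] }
    exact (map_sw (K := K) φ _ h).symm
  · rw [← mul_assoc, a₃, mul_assoc, b₃, mul_assoc]
  · rw [dagger_mul, mul_assoc, ← mul_assoc b, b₄, one_mul, a₄]

theorem isU_one : IsU α (1 : WithConv (H →ₗ[K] A)).ofConv := by
  rw [isU_iff]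
  refine ⟨?_, fun h => ?_, fun c => ?_, ?_⟩
  · simp
  · rw [one_mul, LinearMap.convOne_apply]
    ext g
    simp [transl, orbit, Algebra.algebraMap_eq_smul_one, α.act_one, smul_smul, mul_comm]
  · rw [mul_one, one_mul]
  · rw [dagger_one, one_mul]

theorem left_inv {a : WithConv (H →ₗ[K] A)} (ha : IsU α a.ofConv) : dagger a * a = 1 := by
  rw [isU_iff] at ha
  exact isGL_left_inv ha.1 ha.2.1 ha.2.2.2

theorem isU_inv {a : WithConv (H →ₗ[K] A)} (ha : IsU α a.ofConv) : IsU α (dagger a).ofConv := by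
  have hl := left_inv ha
  rw [isU_iff] at *
  obtain ⟨a₁, a₂, a₃, a₄⟩ := ha
  have h₃ : ∀ c, orbit α c * dagger a = dagger a * orbit α c := fun c => by
    calc orbit α c * dagger a = dagger a * a * (orbit α c * dagger a) := by rw [hl, one_mul]
      _ = dagger a * (a * orbit α c) * dagger a := by simp only [mul_assoc]
      _ = dagger a * orbit α c * (a * dagger a) := by rw [← a₃]; simp only [mul_assoc]
      _ = _ := by rw [a₄, mul_one]
  refine ⟨?_, fun h => ?_, h₃, ?_⟩
  · change star (a (star (HopfAlgebra.antipode K 1))) = 1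
    simp [a₁]
  · rw [← h₃]
    have e₁ : ∀ p : H, sw K (fun c d => transl a c * transl (dagger a) d) p =
        counit (R := K) p • (1 : WithConv (H →ₗ[K] A)) := by
      intro p
      rw [← transl_mul, a₄]
      ext g
      change (1 : WithConv (H →ₗ[K] A)) (g * p) =
        counit (R := K) p • (1 : WithConv (H →ₗ[K] A)) g
      simp only [LinearMap.convOne_apply, Bialgebra.counit_mul, Algebra.algebraMap_eq_smul_one]
      rw [smul_smul, mul_comm]
    have e₂ : ∀ p : H, sw K (fun c d => orbit α (dagger a c) * orbit α (a d)) p =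
        counit (R := K) p • (1 : WithConv (H →ₗ[K] A)) := by
      intro p
      let φ : A →+ WithConv (H →ₗ[K] A) :=
        { toFun := orbit α
          map_zero' := by ext; simp [orbit]
          map_add' := fun x y => by ext; simp [orbit] }
      have := map_sw (K := K) φ (fun c d => dagger a c * a d) p
      rw [← conv_apply, hl] at this
      simp only [φ, AddMonoidHom.coe_mk, ZeroHom.coe_mk, orbit_mul] at this
      rw [← this]
      ext g
      simp [orbit, Algebra.algebraMap_eq_smul_one, α.act_one]
    have t_add : ∀ (x : WithConv (H →ₗ[K] A)) (p q : H),
        transl x (p + q) = transl x p + transl x q := by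
      intros; ext; simp [transl, mul_add]
    have t_smul : ∀ (x : WithConv (H →ₗ[K] A)) (k : K) (p : H),
        transl x (k • p) = k • transl x p := by
      intros; ext; simp [transl]
    have o_add : ∀ (x : WithConv (H →ₗ[K] A)) (p q : H),
        orbit α (x (p + q)) = orbit α (x p) + orbit α (x q) := by
      intros; ext; simp [orbit]
    have o_smul : ∀ (x : WithConv (H →ₗ[K] A)) (k : K) (p : H),
        orbit α (x (k • p)) = k • orbit α (x p) := by
      intros; ext; simp [orbit]
    have e₃ := sw_assoc (K := K) (fun p q r => orbit α (dagger a p) * dagger a * transl a q *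
      transl (dagger a) r) (fun c => ⟨fun p q r => by simp only [o_add, add_mul],
        fun k p q => by simp only [o_smul, smul_mul_assoc],
        fun p q r => by simp only [t_add, add_mul, mul_add],
        fun k p q => by simp only [t_smul, smul_mul_assoc, mul_smul_comm]⟩)
      (fun c => ⟨fun p q r => by simp only [t_add, add_mul, mul_add],
        fun k p q => by simp only [t_smul, smul_mul_assoc, mul_smul_comm],
        fun p q r => by simp only [t_add, mul_add],
        fun k p q => by simp only [t_smul, mul_smul_comm]⟩) h
    have f₁ : ∀ p q : H, sw K (fun c d => orbit α (dagger a c) * dagger a * transl a d *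
        transl (dagger a) q) p = counit (R := K) p • transl (dagger a) q := by
      intro p q
      have : ∀ c d : H, orbit α (dagger a c) * dagger a * transl a d * transl (dagger a) q =
          (orbit α (dagger a c) * orbit α (a d)) * transl (dagger a) q := by
        intro c d
        rw [a₂, mul_assoc (orbit α _) (dagger a), ← mul_assoc (dagger a) a, hl, one_mul]
      rw [sw_congr this]
      refine (map_sw (K := K) (AddMonoidHom.mulRight (transl (dagger a) q)) _ p).symm.trans ?_
      rw [e₂]
      simp
    have f₂ : ∀ p q : H, sw K (fun c d => orbit α (dagger a p) * dagger a * transl a c *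
        transl (dagger a) d) q = counit (R := K) q • (orbit α (dagger a p) * dagger a) := by
      intro p q
      simp only [mul_assoc (orbit α (dagger a p) * dagger a)]
      refine (map_sw (K := K) (AddMonoidHom.mulLeft (orbit α (dagger a p) * dagger a)) _ q).symm.trans
        ?_
      rw [e₁]
      simp
    rw [sw_congr f₁, sw_congr f₂] at e₃
    let T : H →ₗ[K] WithConv (H →ₗ[K] A) :=
      { toFun := transl (dagger a)
        map_add' := t_add _
        map_smul' := t_smul _ }
    let O : H →ₗ[K] WithConv (H →ₗ[K] A) :=
      { toFun := fun p => orbit α (dagger a p) * dagger a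
        map_add' := fun p q => by rw [o_add, add_mul]
        map_smul' := fun k p => by rw [o_smul, smul_mul_assoc]; rfl }
    exact (sw_counit_left T h).symm.trans (e₃.trans (sw_counit_right O h))
  · rw [dagger_dagger, hl]

/-- `U(H, A)` is a group with respect to the convolution product. -/
instance : Group (UGroup α) where
  mul a b := ⟨(toConv a.1 * toConv b.1).ofConv, isU_mul a.2 b.2⟩
  one := ⟨(1 : WithConv (H →ₗ[K] A)).ofConv, isU_one⟩
  inv a := ⟨(dagger (toConv a.1)).ofConv, isU_inv a.2⟩
  mul_assoc a b c := Subtype.ext <|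
    congrArg ofConv (mul_assoc (toConv a.1) (toConv b.1) (toConv c.1))
  one_mul a := Subtype.ext <| congrArg ofConv (one_mul (toConv a.1))
  mul_one a := Subtype.ext <| congrArg ofConv (mul_one (toConv a.1))
  inv_mul_cancel a := Subtype.ext <| congrArg ofConv (left_inv a.2)

theorem coe_mul (a b : UGroup α) : toConv (a * b).1 = toConv a.1 * toConv b.1 := rfl

theorem coe_one : toConv (1 : UGroup α).1 = 1 := rfl

end UGroup

namespace UGroup

variable (A) in
/-- The group of unitary central elements of `A`. -/
def centralUnitary : Subgroup (unitary A) where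
  carrier := {c | ∀ b : A, (c : A) * b = b * c}
  mul_mem' {c d} hc hd b := by
    rw [Submonoid.coe_mul, mul_assoc, hd, ← mul_assoc, hc, mul_assoc]
  one_mem' b := by simp
  inv_mem' {c} hc b := by
    have h := congrArg star (hc (star b))
    rw [star_mul, star_mul, star_star] at h
    exact h.symm

theorem isU_hat_aux (α : StarAction K H A) (c : A) :
    toConv (LinearMap.mulRight K c ∘ₗ α.act.toLinearMap.flip (star c)) =
      orbit α (star c) * toConv (LinearMap.toSpanSingleton K A c ∘ₗ counit) := by
  ext g
  rw [conv_apply]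
  have := sw_counit_right ((LinearMap.mulRight K c) ∘ₗ (α.act.toLinearMap.flip (star c))) g
  refine this.symm.trans (sw_congr (fun p q => ?_) g)
  simp [orbit]

theorem cst_mul {c : A} (hc : ∀ b : A, c * b = b * c) (a : WithConv (H →ₗ[K] A)) :
    toConv (LinearMap.toSpanSingleton K A c ∘ₗ counit) * a =
      a * toConv (LinearMap.toSpanSingleton K A c ∘ₗ counit) := by
  ext g
  rw [conv_apply, conv_apply]
  have h₁ := sw_counit_right ((LinearMap.mulRight K c) ∘ₗ a.ofConv) g
  have h₂ := sw_counit_left ((LinearMap.mulLeft K c) ∘ₗ a.ofConv) g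
  refine Eq.trans ?_ (h₂.trans (Eq.trans ?_ (h₁.symm.trans ?_)))
  · exact sw_congr (fun p q => by simp) g
  · simp [hc]
  · exact sw_congr (fun p q => by simp) g

theorem cst_mul_cst (c d : A) :
    (toConv (LinearMap.toSpanSingleton K A c ∘ₗ counit) : WithConv (H →ₗ[K] A)) *
      toConv (LinearMap.toSpanSingleton K A d ∘ₗ counit) =
      toConv (LinearMap.toSpanSingleton K A (c * d) ∘ₗ counit) := by
  ext g
  rw [conv_apply]
  have h := sw_counit_left (LinearMap.toSpanSingleton K A (c * d) ∘ₗ (counit (R := K) (A := H))) g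
  refine Eq.trans (sw_congr (fun p q => ?_) g) h
  simp [smul_smul, mul_comm]

theorem cst_one : (toConv (LinearMap.toSpanSingleton K A 1 ∘ₗ counit) : WithConv (H →ₗ[K] A)) = 1 := by
  ext g
  simp [Algebra.algebraMap_eq_smul_one]

theorem dagger_orbit (α : StarAction K H A) (b : A) : dagger (orbit α b) = orbit α (star b) := by
  ext g
  exact α.act_star_apply g b

theorem dagger_cst (c : A) :
    dagger (toConv (LinearMap.toSpanSingleton K A c ∘ₗ counit) : WithConv (H →ₗ[K] A)) =
      toConv (LinearMap.toSpanSingleton K A (star c) ∘ₗ counit) := by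
  ext g
  simp [dagger, IsHopfStar.counit_star]

theorem isU_hat (α : StarAction K H A) (c : centralUnitary A) :
    IsU α (LinearMap.mulRight K (c.1 : A) ∘ₗ α.act.toLinearMap.flip (star (c.1 : A))) := by
  obtain ⟨⟨c, hu⟩, hc⟩ := c
  replace hc : ∀ b : A, c * b = b * c := hc
  have hu₁ : star c * c = 1 := (Unitary.mem_iff.1 hu).1
  have hu₂ : c * star c = 1 := (Unitary.mem_iff.1 hu).2
  have hc' : ∀ b : A, star c * b = b * star c := fun b => by
    have h := congrArg star (hc (star b))
    rw [star_mul, star_mul, star_star] at h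
    exact h.symm
  refine (isU_iff α (toConv (LinearMap.mulRight K c ∘ₗ α.act.toLinearMap.flip (star c)))).2
    ⟨?_, fun h => ?_, fun b => ?_, ?_⟩
  · simpa using hu₁
  · have e : transl (toConv (LinearMap.mulRight K c ∘ₗ α.act.toLinearMap.flip (star c))) h =
        orbit α (α.act h (star c)) * toConv (LinearMap.toSpanSingleton K A c ∘ₗ counit) := by
      ext g
      rw [conv_apply]
      have := sw_counit_right ((LinearMap.mulRight K c) ∘ₗ
        (α.act.toLinearMap.flip (α.act h (star c)))) g
      refine Eq.trans ?_ (this.symm.trans (sw_congr (fun p q => ?_) g))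
      · simp [transl]
      · simp [orbit]
    have v : (toConv (LinearMap.mulRight K c ∘ₗ α.act.toLinearMap.flip (star c))) h =
      α.act h (star c) * c := rfl
    rw [v, e, isU_hat_aux, mul_assoc, cst_mul hc, ← mul_assoc, ← orbit_mul, hc', mul_assoc, hu₂,
      mul_one]
  · rw [isU_hat_aux, mul_assoc, cst_mul hc, ← mul_assoc, ← mul_assoc, ← orbit_mul, ← orbit_mul, hc']
  · have key : ∀ x : WithConv (H →ₗ[K] A), toConv (LinearMap.toSpanSingleton K A c ∘ₗ counit) *
        (toConv (LinearMap.toSpanSingleton K A (star c) ∘ₗ counit) * x) = x := fun x => by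
      rw [← mul_assoc, cst_mul_cst, hu₂, cst_one, one_mul]
    rw [isU_hat_aux, dagger_mul, dagger_orbit, dagger_cst, star_star, mul_assoc, key,
      ← orbit_mul, hu₁, orbit_one]

/-- The homomorphism `c ↦ ĉ`, where `ĉ(g) = (g ▷ c⁻¹) c`. -/
def hat (α : StarAction K H A) : centralUnitary A →* UGroup α where
  toFun c := ⟨LinearMap.mulRight K (c.1 : A) ∘ₗ α.act.toLinearMap.flip (star (c.1 : A)), isU_hat α c⟩
  map_one' := by
    refine Subtype.ext ?_
    change LinearMap.mulRight K (1 : A) ∘ₗ α.act.toLinearMap.flip (star (1 : A)) =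
      (1 : WithConv (H →ₗ[K] A)).ofConv
    ext g
    simp [α.act_one, Algebra.algebraMap_eq_smul_one]
  map_mul' c d := by
    obtain ⟨⟨c, hu⟩, hc⟩ := c
    obtain ⟨⟨d, hv⟩, hd⟩ := d
    replace hc : ∀ b : A, c * b = b * c := hc
    refine Subtype.ext (toConv_injective ?_)
    change toConv (LinearMap.mulRight K (c * d) ∘ₗ α.act.toLinearMap.flip (star (c * d))) =
      toConv (LinearMap.mulRight K c ∘ₗ α.act.toLinearMap.flip (star c)) *
      toConv (LinearMap.mulRight K d ∘ₗ α.act.toLinearMap.flip (star d))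
    rw [isU_hat_aux, isU_hat_aux, isU_hat_aux, hc d, star_mul, orbit_mul, ← hc d, ← cst_mul_cst]
    have k := cst_mul hc (orbit α (star d) * toConv (LinearMap.toSpanSingleton K A d ∘ₗ counit))
    simp only [mul_assoc] at k ⊢
    rw [k, cst_mul_cst, cst_mul_cst, hc d]

theorem hat_apply (α : StarAction K H A) (c : centralUnitary A) (g : H) :
    (hat α c).1 g = α.act g ((c⁻¹).1 : A) * (c.1 : A) := rfl

theorem commute_hat (α : StarAction K H A) (c : centralUnitary A) (a : UGroup α) :
    a * hat α c = hat α c * a := by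
  refine Subtype.ext (toConv_injective ?_)
  rw [coe_mul, coe_mul]
  change toConv a.1 * toConv (LinearMap.mulRight K (c.1 : A) ∘ₗ
      α.act.toLinearMap.flip (star (c.1 : A))) =
    toConv (LinearMap.mulRight K (c.1 : A) ∘ₗ α.act.toLinearMap.flip (star (c.1 : A))) *
      toConv a.1
  rw [isU_hat_aux, ← mul_assoc, ← ((isU_iff α (toConv a.1)).1 a.2).2.2.1, mul_assoc, mul_assoc,
    cst_mul c.2]

instance (α : StarAction K H A) : (hat α).range.Normal where
  conj_mem := by
    rintro _ ⟨c, rfl⟩ a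
    exact ⟨c, by rw [commute_hat, mul_assoc, mul_inv_cancel, mul_one]⟩

end UGroup

/-- The group `U₀(H, A)`, the quotient of `U(H, A)` by the image of the unitary central elements. -/
abbrev UZero (α : StarAction K H A) : Type _ := UGroup α ⧸ (UGroup.hat α).range

end Unitary

/-! ### Twisted actions on the canonical bimodule and lifts by momentum maps -/

section Lifts

variable {R : Type v} [CommRing R] [LinearOrder R] [IsStrictOrderedRing R]
  {H : Type w} [Ring H] [HopfAlgebra (Cx R) H] [StarRing H] [StarModule (Cx R) H]
  {A B : HStarAlg.{v, w, u} R H}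

/-- The action of `H` on the canonical bimodule `A` is `(g, x) ↦ a(g₍₁₎) (g₍₂₎ ▷ x)`. -/
def IsTwist (a : H →ₗ[Cx R] A.alg.carrier)
    (e : HAction A.action A.action (Rep.unit (R := R) A.alg.carrier)) : Prop :=
  ∀ g x, e.act g (Rep.ofAlg x) =
    Rep.ofAlg (sw (Cx R) (fun g₁ g₂ => a g₁ * A.action.act g₂ x) g)

/-- The action of `H` on the bimodule `E` is `(g, x) ↦ J_B(g₍₁₎) · x · J_A(S(g₍₂₎))`. -/
def IsMomentumLift (JB : H →⋆ₐ[Cx R] B.alg.carrier) (JA : H →⋆ₐ[Cx R] A.alg.carrier)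
    {E : Rep R B.alg.carrier A.alg.carrier} (e : HAction B.action A.action E) : Prop :=
  ∀ g x, e.act g x = sw (Cx R) (fun g₁ g₂ => E.left (JB g₁)
    (E.right (.op (JA (HopfAlgebra.antipode (Cx R) g₂))) x)) g

end Lifts

end StrongPicard

end

/-!
Momentum maps `J_B` and `J_A` equip every `(B, A)`-bimodule with the action
`g ▷ x = J_B(g₍₁₎) · x · J_A(S(g₍₂₎))` (`Rep.momentumAct`). It is compatible with the inner product
and with the left multiplication (`HAction.momentum`): in both verifications a factor `J_B(S(g₍₂₎))`
meets the `J_B(g₍₃₎)` of an adjacent action and cancels (`Rep.sw_left_antipode_momentumAct`).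
Isometric isomorphisms are automatically equivariant for these actions, the canonical bimodule
receives its own action, and by the same cancellation, across the balanced tensor product, the
action of an internal tensor product is the diagonal one (`HAction.momentum_tensor`). Lifting along
the momentum maps is hence functorial. So it preserves invertibility, which proves surjectivity, and
for `B = A` it gives a group homomorphism splitting the forgetful one.

For the kernel one works in the convolution algebra of linear maps `H → A`. With `a^†(g) = a(S(g)^*)^*`
and writing `x` also for the orbit `g ↦ g ▷ x`, the twisted action by `a` is the convolution product
`a x`, and the conditions defining `U(H, A)` say that `a` is compatible with products in `H`, commutes
with orbits, and satisfies `a a^† = 1`. Twisting turns convolution into the tensor product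
(`HAction.exists_twist_tensor`). Conversely, an action on the canonical bimodule is the twist by
`a(g) = g ▷ 1`: right `A`-linearity gives the form of the action, left linearity the commutation
with orbits, and the inner product of `1` with itself gives `a^† a = 1`
(`HAction.exists_eq_twist`). Finally, an isometric automorphism of the canonical bimodule is the
multiplication by a unitary central element, so two twists agree up to isomorphism exactly modulo
the elements `ĉ` (`HAction.exists_twist_hat`, `HAction.exists_hat_of_equivariant`).
-/

noncomputable section

namespace StrongPicard

section

variable {R : Type v} [CommRing R] [LinearOrder R] [IsStrictOrderedRing R]
  {A : Type u} [Ring A] [StarRing A] [Algebra (Cx R) A] [StarModule (Cx R) A]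
  {B : Type u} [Ring B] [StarRing B] [Algebra (Cx R) B] [StarModule (Cx R) B]
  {C : Type u} [Ring C] [StarRing C] [Algebra (Cx R) C] [StarModule (Cx R) C]
  {H : Type w} [Ring H] [HopfAlgebra (Cx R) H] [StarRing H] [StarModule (Cx R) H]

/-! ### Lifting bimodules along momentum maps -/

namespace Rep

/-- Right multiplication by `J(S(g))`, as a representation of `H`. It is a left action of `H`
because both the antipode and `a ↦ right (op a)` reverse products. -/
def rightAntipode (J : H →⋆ₐ[Cx R] A) (E : Rep R B A) :
    H →ₐ[Cx R] Module.End (Cx R) E.carrier :=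
  E.right.comp ((AlgHom.op (J : H →ₐ[Cx R] A)).comp (HopfAlgebra.antipodeAlgHomOp (Cx R) H))

theorem left_commute_rightAntipode (JB : H →⋆ₐ[Cx R] B) (JA : H →⋆ₐ[Cx R] A) (E : Rep R B A)
    (g h : H) : Commute (E.left.comp (JB : H →ₐ[Cx R] B) g) (rightAntipode JA E h) :=
  LinearMap.ext fun x => E.left_right (JB g) (JA (HopfAlgebra.antipode (Cx R) h)) x

/-- The action `g ▷ x = J_B(g₍₁₎) · x · J_A(S(g₍₂₎))` of `H` on a bimodule. -/
def momentumAct (JB : H →⋆ₐ[Cx R] B) (JA : H →⋆ₐ[Cx R] A) (E : Rep R B A) :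
    H →ₐ[Cx R] Module.End (Cx R) E.carrier :=
  (Algebra.TensorProduct.lift (E.left.comp (JB : H →ₐ[Cx R] B)) (rightAntipode JA E)
    (left_commute_rightAntipode JB JA E)).comp (Bialgebra.comulAlgHom (Cx R) H)

variable (JB : H →⋆ₐ[Cx R] B) (JA : H →⋆ₐ[Cx R] A) (E : Rep R B A)

theorem momentumAct_apply (g : H) (x : E.carrier) :
    momentumAct JB JA E g x = sw (Cx R) (fun g₁ g₂ => E.left (JB g₁)
      (E.right (.op (JA (HopfAlgebra.antipode (Cx R) g₂))) x)) g := by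
  simp only [momentumAct, AlgHom.comp_apply, Bialgebra.comulAlgHom_apply]
  rw [← (ℛ (Cx R) g).eq, map_sum, LinearMap.sum_apply]
  refine Finset.sum_congr rfl fun i _ => ?_
  rw [Algebra.TensorProduct.lift_tmul]
  rfl

/-- Multiplying by `J_B(S(g₍₁₎))` from the left strips the left half off the action of `g₍₂₎`. -/
theorem sw_left_antipode_momentumAct (g : H) (x : E.carrier) :
    sw (Cx R) (fun a b => E.left (JB (HopfAlgebra.antipode (Cx R) a)) (momentumAct JB JA E b x)) g =
      E.right (.op (JA (HopfAlgebra.antipode (Cx R) g))) x := by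
  simp only [momentumAct_apply, map_sw]
  rw [← sw_assoc (fun a c d => E.left (JB (HopfAlgebra.antipode (Cx R) a)) (E.left (JB c)
    (E.right (.op (JA (HopfAlgebra.antipode (Cx R) d))) x)))]
  · have h : ∀ a b : H, sw (Cx R) (fun c d => E.left (JB (HopfAlgebra.antipode (Cx R) c))
        (E.left (JB d) (E.right (.op (JA (HopfAlgebra.antipode (Cx R) b))) x))) a =
        counit (R := Cx R) a • E.right (.op (JA (HopfAlgebra.antipode (Cx R) b))) x := by
      intro a b
      have h := map_sw (K := Cx R) ((E.left.comp (JB : H →ₐ[Cx R] B)).toLinearMap.flip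
        (E.right (.op (JA (HopfAlgebra.antipode (Cx R) b))) x))
        (fun c d => HopfAlgebra.antipode (Cx R) c * d) a
      rw [sw_antipode_mul] at h
      simpa using h.symm
    rw [sw_congr h]
    exact sw_counit_left ((rightAntipode JA E).toLinearMap.flip x) g
  · intro c
    constructor <;> intros <;> simp
  · intro c
    constructor <;> intros <;> simp

end Rep

theorem antipode_star_antipode [IsHopfStar (Cx R) H] (g : H) :
    HopfAlgebra.antipode (Cx R) (star (HopfAlgebra.antipode (Cx R) g)) = star g := by
  have := IsHopfStar.antipode_star (K := Cx R) (star g)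
  rwa [star_star] at this

namespace HAction

variable [IsHopfStar (Cx R) H] {α : StarAction (Cx R) H A} {β : StarAction (Cx R) H B}
  {γ : StarAction (Cx R) H C}

/-- The adjoint of `x ↦ S(g)^* ▷ x`: moving the right multiplication out of the inner product leaves
the factor `J_A(g₍₁₎)` on the left, because `S(S(g)^*) = g^*`, and the left multiplication moves to
the other argument as `J_B(S(g₍₂₎))`. -/
theorem inner_momentumAct_star_antipode (JB : H →⋆ₐ[Cx R] B) (JA : H →⋆ₐ[Cx R] A)
    (E : Rep R B A) (g : H) (x y : E.carrier) :
    E.inner (Rep.momentumAct JB JA E (star (HopfAlgebra.antipode (Cx R) g)) x) y =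
      sw (Cx R) (fun a b => JA a * E.inner x (E.left (JB (HopfAlgebra.antipode (Cx R) b)) y)) g := by
  have bil₁ : IsBil (Cx R) (fun a b => E.left (JB a)
      (E.right (.op (JA (HopfAlgebra.antipode (Cx R) b))) x)) := by
    constructor <;> intros <;> simp
  have bil₂ : IsBil (Cx R) (fun a b => E.inner (E.left (JB (star a))
      (E.right (.op (JA (HopfAlgebra.antipode (Cx R) (star b)))) x)) y) := by
    constructor <;> intros <;> simp [Rep.inner_add_left, Rep.inner_smul_left]
  let Φ : E.carrier →+ A :=
    { toFun := fun z => E.inner z y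
      map_zero' := E.inner_zero_left y
      map_add' := fun z z' => E.inner_add_left z z' y }
  rw [Rep.momentumAct_apply, sw_star bil₁]
  refine (map_sw (K := Cx R) Φ _ _).trans ((sw_antipode bil₂ g).trans (sw_congr (fun a b => ?_) g))
  rw [antipode_star_antipode, E.inner_left', ← map_star, star_star, E.inner_right', ← map_star,
    star_star]

/-- The action of `H` on a bimodule given by momentum maps of both algebras. -/
def momentum {JB : H →⋆ₐ[Cx R] B} {JA : H →⋆ₐ[Cx R] A} (hB : IsMomentumMap β JB)
    (hA : IsMomentumMap α JA) (E : Rep R B A) : HAction β α E where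
  act := Rep.momentumAct JB JA E
  act_inner g x y := by
    -- `J_A(g₍₁₎) ⟨x, J_B(S(g₍₂₎)) · (g₍₃₎ ▷ y)⟩`, where the last two legs combine first.
    simp only [inner_momentumAct_star_antipode]
    rw [sw_assoc (fun c d b => JA c * E.inner x (E.left
          (JB (HopfAlgebra.antipode (Cx R) d)) (Rep.momentumAct JB JA E b y))), hA]
    · refine sw_congr (fun a b => ?_) g
      rw [mul_assoc, ← E.inner_right, ← Rep.sw_left_antipode_momentumAct JB, map_sw]
      exact map_sw (K := Cx R) (AddMonoidHom.mulLeft (JA a)) _ b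
    · intro c
      constructor <;> intros <;> simp [add_mul, mul_add]
    · intro c
      constructor <;> intros <;> simp [add_mul, mul_add]
  act_left g b x := by
    -- `J_B(g₍₁₎) b J_B(S(g₍₂₎)) · (g₍₃₎ ▷ x)`, where the last two legs combine first.
    have h : ∀ p q : H, E.left (β.act p b) (Rep.momentumAct JB JA E q x) =
        sw (Cx R) (fun c d => E.left (JB c * b) (E.left (JB (HopfAlgebra.antipode (Cx R) d))
          (Rep.momentumAct JB JA E q x))) p := by
      intro p q
      rw [hB]
      refine (map_sw (K := Cx R) (E.left.toLinearMap.flip (Rep.momentumAct JB JA E q x)) _ p).trans ?_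
      exact sw_congr (fun c d => by simp) p
    rw [sw_congr h, sw_assoc (fun c d q => E.left (JB c * b)
      (E.left (JB (HopfAlgebra.antipode (Cx R) d)) (Rep.momentumAct JB JA E q x))),
      Rep.momentumAct_apply]
    · refine sw_congr (fun p q => ?_) g
      rw [← map_sw, Rep.sw_left_antipode_momentumAct]
      simp only [map_mul, Module.End.mul_apply, E.left_right]
    · intro c
      constructor <;> intros <;> simp [add_mul, mul_add]
    · intro c
      constructor <;> intros <;> simp [add_mul, mul_add]

variable {JA : H →⋆ₐ[Cx R] A} {JB : H →⋆ₐ[Cx R] B} {JC : H →⋆ₐ[Cx R] C}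
  (hA : IsMomentumMap α JA) (hB : IsMomentumMap β JB) (hC : IsMomentumMap γ JC)

@[ext]
theorem ext {E : Rep R B A} {e f : HAction β α E} (h : ∀ g x, e.act g x = f.act g x) : e = f := by
  cases e
  cases f
  congr
  exact AlgHom.ext fun g => LinearMap.ext (h g)

theorem momentum_unit : momentum hA hA (Rep.unit A) = unit α := by
  ext g x
  refine (Rep.momentumAct_apply JA JA (Rep.unit A) g x).trans ((hA g x).trans ?_).symm
  exact sw_congr (fun a b => mul_assoc _ _ _) g

/-- In the diagonal action the inner factors `J_B(S(g₍₂₎))` and `J_B(g₍₃₎)` cancel, because the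
internal tensor product is balanced over `B`. -/
theorem momentum_tensor (F : Rep R C B) (E : Rep R B A) :
    momentum hC hA (Rep.tensor F E) = tensor (momentum hC hB F) (momentum hB hA E) := by
  ext g x
  obtain ⟨t, rfl⟩ := Rep.tensorMk_surjective F E x
  rw [tensor_act_mk]
  refine (Rep.momentumAct_apply JC JA (Rep.tensor F E) g _).trans ?_
  change sw (Cx R) (fun a b => Rep.tensorMk F E (Rep.tensorLeft F E (JC a) (Rep.tensorRight F E
    (.op (JA (HopfAlgebra.antipode (Cx R) b))) t))) g = Rep.tensorMk F E
      (diag (Rep.momentumAct JC JB F) (Rep.momentumAct JB JA E) g t)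
  induction t with
  | zero => simp [sw]
  | add s t hs ht => 
    simp only [map_add]
    rw [← hs, ← ht]
    exact Finset.sum_add_distrib
  | tmul φ x =>
    have h : ∀ p q : H, Rep.tensorMk F E
        (Rep.momentumAct JC JB F p φ ⊗ₜ Rep.momentumAct JB JA E q x) =
        sw (Cx R) (fun c d => Rep.tensorMk F E (F.left (JC c) φ ⊗ₜ E.left
          (JB (HopfAlgebra.antipode (Cx R) d)) (Rep.momentumAct JB JA E q x))) p := by
      intro p q
      rw [Rep.momentumAct_apply]
      refine (map_sw (K := Cx R) ((Rep.tensorMk F E).comp ((TensorProduct.mk (Cx R) _ _).flip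
        (Rep.momentumAct JB JA E q x))) _ p).trans (sw_congr (fun c d => ?_) p)
      rw [F.left_right]
      exact (Submodule.Quotient.eq _).2 (Rep.balanced_mem_radical F E _ _ _)
    rw [diag_tmul, map_sw, sw_congr h, sw_assoc (fun c d q => Rep.tensorMk F E (F.left (JC c) φ ⊗ₜ
      E.left (JB (HopfAlgebra.antipode (Cx R) d)) (Rep.momentumAct JB JA E q x)))]
    · refine sw_congr (fun p q => ?_) g
      rw [Rep.tensorRight_tmul, Rep.tensorLeft_tmul, ← Rep.sw_left_antipode_momentumAct JB]
      exact map_sw (K := Cx R) ((Rep.tensorMk F E).comp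
        (TensorProduct.mk (Cx R) _ _ (F.left (JC p) φ))) _ q
    · intro c
      constructor <;> intros <;>
        simp [TensorProduct.add_tmul, TensorProduct.tmul_add, TensorProduct.smul_tmul]
    · intro c
      constructor <;> intros <;>
        simp [TensorProduct.add_tmul, TensorProduct.tmul_add, TensorProduct.smul_tmul]

theorem equivariant_momentum {E E' : Rep R B A} (φ : E.Iso E') :
    Equivariant (momentum hB hA E) (momentum hB hA E') φ := fun g x => by
  change φ.toEquiv (Rep.momentumAct JB JA E g x) = Rep.momentumAct JB JA E' g (φ.toEquiv x)
  rw [Rep.momentumAct_apply, Rep.momentumAct_apply, map_sw]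
  exact sw_congr (fun a b => by rw [φ.map_left, φ.map_right]) g

end HAction

end

section

open WithConv

variable {K : Type*} [CommRing K] [StarRing K] {H : Type*} [Ring H] [HopfAlgebra K H]
  [StarRing H] [StarModule K H] {A : Type*} [Ring A] [StarRing A] [Algebra K A] [StarModule K A]

/-! ### Twisted actions -/

variable (α : StarAction K H A)

/-- The additive map sending `b` to its orbit `g ↦ g ▷ b`. -/
def orbitHom : A →+ WithConv (H →ₗ[K] A) where
  toFun := orbit α
  map_zero' := by ext; simp [orbit]
  map_add' x y := by ext; simp [orbit]

theorem orbit_add (x y : A) : orbit α (x + y) = orbit α x + orbit α y := map_add (orbitHom α) x y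

theorem orbit_smul (k : K) (x : A) : orbit α (k • x) = k • orbit α x := by ext; simp [orbit]

theorem transl_orbit (b : A) (h : H) : transl (orbit α b) h = orbit α (α.act h b) := by
  ext g
  simp [transl, orbit]

variable {α}

variable [IsHopfStar K H]

/-- The representation `(g, x) ↦ a(g₍₁₎) (g₍₂₎ ▷ x)` of `H` on `A`. In the convolution algebra of
linear maps `H → A`, the map `g ↦ a(g₍₁₎) (g₍₂₎ ▷ x)` is the product of `a` and the orbit of `x`. -/
def twistAct {a : H →ₗ[K] A} (ha : IsGL α a) : H →ₐ[K] Module.End K A :=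
  AlgHom.ofLinearMap
    { toFun := fun g =>
        { toFun := fun x => (toConv a * orbit α x) g
          map_add' := fun x y => by rw [orbit_add, mul_add]; rfl
          map_smul' := fun k x => by rw [orbit_smul, mul_smul_comm]; rfl }
      map_add' := fun g h => LinearMap.ext fun x => map_add (toConv a * orbit α x).ofConv g h
      map_smul' := fun k g => LinearMap.ext fun x => map_smul (toConv a * orbit α x).ofConv k g }
    (LinearMap.ext fun x => by
      change (toConv a * orbit α x) 1 = x
      rw [conv_apply, sw_one (conv_bil _ _)]
      simp [ha.map_one, orbit])
    (fun g h => LinearMap.ext fun x => by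
      change transl (toConv a * orbit α x) h g =
        (toConv a * orbit α ((toConv a * orbit α x) h)) g
      have ht : ∀ k, transl (toConv a) k = toConv a * orbit α (a k) := fun k => by
        ext g
        exact (ha.map_mul g k).trans (conv_apply (toConv a) (orbit α (a k)) g).symm
      refine congrArg (fun c : WithConv (H →ₗ[K] A) => c g) ?_
      rw [transl_mul, conv_apply]
      refine Eq.trans (sw_congr (fun p q => ?_) h)
        (map_sw (K := K) ((AddMonoidHom.mulLeft (toConv a)).comp (orbitHom α)) _ h).symm
      rw [ht, transl_orbit, mul_assoc, ← orbit_mul]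
      rfl)

theorem twistAct_apply {a : H →ₗ[K] A} (ha : IsGL α a) (g : H) (x : A) :
    twistAct ha g x = (toConv a * orbit α x) g := rfl

/-- One-sided inverses of twists are two-sided: if `x ↦ a(g₍₁₎) (g₍₂₎ ▷ x)` is a representation of
`H`, then both it and the action are invertible in the convolution algebra of maps `H → End(A)`,
and so is `a`. -/
theorem mul_eq_one_of_algHom {a b : WithConv (H →ₗ[K] A)} (f : H →ₐ[K] Module.End K A)
    (hf : ∀ g x, f g x = (a * orbit α x) g) (hba : b * a = 1) : a * b = 1 := by
  have h₁ : toConv f.toLinearMap = lconv a * toConv α.act.toLinearMap := by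
    ext g x
    refine (hf g x).trans ?_
    rw [conv_apply, (ℛ K g).convMul_apply, LinearMap.sum_apply]
    rfl
  have h₂ : lconv a * (toConv α.act.toLinearMap *
      toConv (f.toLinearMap ∘ₗ HopfAlgebra.antipode K)) = 1 := by
    rw [← mul_assoc, ← h₁, (algHom_conv f).1]
  have h₃ : lconv b * lconv a = 1 := by rw [← lconv_mul, hba, lconv_one]
  apply lconv_injective
  rw [lconv_mul, lconv_one, left_inv_eq_right_inv h₃ h₂, h₂]

end

section

open WithConv

variable {R : Type v} [CommRing R] [LinearOrder R] [IsStrictOrderedRing R]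
  {A : Type u} [Ring A] [StarRing A] [Algebra (Cx R) A] [StarModule (Cx R) A]
  {B : Type u} [Ring B] [StarRing B] [Algebra (Cx R) B] [StarModule (Cx R) B]
  {H : Type w} [Ring H] [HopfAlgebra (Cx R) H] [StarRing H] [StarModule (Cx R) H]

namespace HAction

/-- Transport of an action of `H` along an isometric isomorphism. -/
def transport {α : StarAction (Cx R) H A} {β : StarAction (Cx R) H B} {E F : Rep R B A}
    (e : HAction β α E) (φ : E.Iso F) : HAction β α F where
  act := (φ.toEquiv.conjAlgEquiv (Cx R)).toAlgHom.comp e.act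
  act_inner g x y := by
    obtain ⟨x, rfl⟩ := φ.toEquiv.surjective x
    obtain ⟨y, rfl⟩ := φ.toEquiv.surjective y
    rw [φ.inner_map, e.act_inner]
    exact sw_congr (fun a b => by simp [LinearEquiv.conjAlgEquiv, φ.inner_map]) g
  act_left g b x := by
    obtain ⟨x, rfl⟩ := φ.toEquiv.surjective x
    have h : ∀ (g : H) (x : E.carrier), ((φ.toEquiv.conjAlgEquiv (Cx R)).toAlgHom.comp e.act) g
        (φ.toEquiv x) = φ.toEquiv (e.act g x) := fun g x => by simp [LinearEquiv.conjAlgEquiv]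
    rw [← φ.map_left, h, e.act_left, map_sw]
    exact sw_congr (fun p q => by rw [h, φ.map_left]) g

theorem equivariant_transport {α : StarAction (Cx R) H A} {β : StarAction (Cx R) H B}
    {E F : Rep R B A} (e : HAction β α E) (φ : E.Iso F) : Equivariant e (e.transport φ) φ :=
  fun g x => by simp [transport, LinearEquiv.conjAlgEquiv]

variable [IsHopfStar (Cx R) H] {α : StarAction (Cx R) H A}

/-- The twisted action on the canonical bimodule. Compatibility with the inner product amounts to
`x^* y = (x^* a^†) (a y)` for orbits in the convolution algebra, where `a^† a = 1`. -/
def twist (a : UGroup α) : HAction α α (Rep.unit (R := R) A) where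
  act := (twistAct a.2.toIsGL : H →ₐ[Cx R] Module.End (Cx R) A)
  act_inner g x y := by
    obtain ⟨x, rfl⟩ := Rep.ofAlg.surjective x
    obtain ⟨y, rfl⟩ := Rep.ofAlg.surjective y
    have h : orbit α (star x * y) = dagger (toConv a.1 * orbit α x) * (toConv a.1 * orbit α y) := by
      rw [dagger_mul, UGroup.dagger_orbit, mul_assoc, ← mul_assoc (dagger (toConv a.1)),
        UGroup.left_inv (a := toConv a.1) a.2, one_mul, orbit_mul]
    exact (congrArg (fun c : WithConv (H →ₗ[Cx R] A) => c g) h).trans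
      (conv_apply (dagger (toConv a.1 * orbit α x)) (toConv a.1 * orbit α y) g)
  act_left g b x := by
    obtain ⟨x, rfl⟩ := Rep.ofAlg.surjective x
    have h : toConv a.1 * orbit α (b * x) = orbit α b * (toConv a.1 * orbit α x) := by
      rw [orbit_mul, ← mul_assoc, ← ((isU_iff α (toConv a.1)).1 a.2).2.2.1, mul_assoc]
    exact (congrArg (fun c : WithConv (H →ₗ[Cx R] A) => c g) h).trans
      (conv_apply (orbit α b) (toConv a.1 * orbit α x) g)

theorem twist_act (a : UGroup α) (g : H) (x : A) :
    (twist (R := R) a).act g (Rep.ofAlg x) = Rep.ofAlg ((toConv a.1 * orbit α x) g) := rfl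

theorem twist_one : twist (R := R) (1 : UGroup α) = unit α := by
  ext g x
  obtain ⟨x, rfl⟩ := Rep.ofAlg.surjective x
  rw [twist_act, UGroup.coe_one, one_mul]
  rfl

theorem exists_twist_tensor (a b : UGroup α) :
    ∃ χ : (Rep.tensor (Rep.unit (R := R) A) (Rep.unit A)).Iso (Rep.unit A),
      Equivariant (tensor (twist a) (twist b)) (twist (a * b)) χ := by
  obtain ⟨χ, hχ⟩ := Rep.exists_unit_tensor (Rep.unit (R := R) A)
  refine ⟨χ, fun g x => ?_⟩
  obtain ⟨t, rfl⟩ := Rep.tensorMk_surjective _ _ x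
  rw [hχ, tensor_act_mk, hχ]
  induction t with
  | zero => simp
  | add s t hs ht => simp only [map_add, hs, ht]
  | tmul x y =>
    obtain ⟨x, rfl⟩ := Rep.ofAlg.surjective x
    obtain ⟨y, rfl⟩ := Rep.ofAlg.surjective y
    have h : (toConv a.1 * orbit α x) * (toConv b.1 * orbit α y) =
        toConv (a * b).1 * orbit α (x * y) := by
      rw [UGroup.coe_mul, orbit_mul, mul_assoc, ← mul_assoc (orbit α x),
        ((isU_iff α (toConv b.1)).1 b.2).2.2.1]
      simp only [mul_assoc]
    rw [diag_tmul, map_sw, Rep.unitTensorMap_tmul, Rep.unit_left, twist_act, ← h, conv_apply]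
    exact (map_sw (K := Cx R) (Rep.ofAlg (R := R) (A := A)) (fun p q =>
      (toConv a.1 * orbit α x) p * (toConv b.1 * orbit α y) q) g).symm

/-- Every compatible action on the canonical bimodule is twisted by `g ↦ g ▷ 1`. Compatibility with
the inner product yields `a^† a = 1`; as `g ↦ a(g)` has a right inverse in the convolution algebra
of maps `H → End(A)`, this implies `a a^† = 1`. -/
theorem exists_eq_twist (e : HAction α α (Rep.unit (R := R) A)) : ∃ a : UGroup α, e = twist a := by
  let a : WithConv (H →ₗ[Cx R] A) := toConv
    (Rep.ofAlg.symm.toLinearMap ∘ₗ e.act.toLinearMap.flip (Rep.ofAlg (R := R) (1 : A)))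
  have hact : ∀ g x, e.act g (Rep.ofAlg x) = Rep.ofAlg ((a * orbit α x) g) := fun g x => by
    have h := e.act_right g x (Rep.ofAlg 1)
    rw [Rep.unit_right, one_mul] at h
    rw [h, conv_apply]
    rfl
  have hact' : ∀ g x, e.act g (Rep.ofAlg x) = Rep.ofAlg ((orbit α x * a) g) := fun g x => by
    have h := e.act_left g x (Rep.ofAlg 1)
    rw [Rep.unit_left, mul_one] at h
    rw [h, conv_apply]
    rfl
  have hval : ∀ g, Rep.ofAlg (R := R) (a g) = e.act g (Rep.ofAlg 1) := fun g => rfl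
  have hl : dagger a * a = 1 := by
    ext g
    rw [conv_apply]
    have h := e.act_inner g (Rep.ofAlg 1) (Rep.ofAlg 1)
    rw [Rep.unit_inner, star_one, one_mul, α.act_one] at h
    exact h.symm.trans (Algebra.algebraMap_eq_smul_one _).symm
  have hr : a * dagger a = 1 := mul_eq_one_of_algHom (e.act : H →ₐ[Cx R] Module.End (Cx R) A) hact hl
  have hU : IsU α a.ofConv := by
    refine (isU_iff α a).2 ⟨?_, fun h => ?_, fun b => ?_, hr⟩
    · apply (Rep.ofAlg (R := R)).injective
      rw [hval, map_one]
      rfl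
    · ext g
      apply (Rep.ofAlg (R := R)).injective
      rw [← hact, hval, ← Module.End.mul_apply, ← map_mul]
      rfl
    · ext g
      apply (Rep.ofAlg (R := R)).injective
      rw [← hact, ← hact']
  refine ⟨⟨a.ofConv, hU⟩, HAction.ext fun g x => ?_⟩
  obtain ⟨x, rfl⟩ := Rep.ofAlg.surjective x
  exact hact g x

/-- Multiplication by the unitary central element `c^*` untwists `ĉ`. -/
theorem exists_twist_hat (c : UGroup.centralUnitary A) :
    ∃ χ : (Rep.unit (R := R) A).Iso (Rep.unit A),
      Equivariant (twist (UGroup.hat α c)) (unit α) χ := by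
  obtain ⟨⟨c, hu⟩, hc⟩ := c
  replace hc : ∀ b : A, c * b = b * c := hc
  have hu₁ : star c * c = 1 := (Unitary.mem_iff.1 hu).1
  have hu₂ : c * star c = 1 := (Unitary.mem_iff.1 hu).2
  have hc' : ∀ b : A, star c * b = b * star c :=
    (UGroup.centralUnitary A).inv_mem (x := ⟨c, hu⟩) hc
  let φ : A ≃ₗ[Cx R] A := LinearEquiv.ofLinearMap (LinearMap.mulLeft (Cx R) (star c))
    (LinearMap.mulLeft (Cx R) c) (LinearMap.ext fun x => by simp [← mul_assoc, hu₁])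
    (LinearMap.ext fun x => by simp [← mul_assoc, hu₂])
  refine ⟨⟨φ, fun (x y : A) => ?_, fun b (x : A) => ?_⟩, fun g (x : A) => ?_⟩
  · change star (star c * x) * (star c * y) = star x * y
    rw [star_mul, star_star, mul_assoc, ← mul_assoc c, hu₂, one_mul]
  · change star c * (b * x) = b * (star c * x)
    rw [← mul_assoc, ← mul_assoc, hc']
  · change star c * (toConv (LinearMap.mulRight (Cx R) c ∘ₗ α.act.toLinearMap.flip (star c)) *
      orbit α x) g = α.act g (star c * x)
    have h : (orbit α (star c * x) * toConv (LinearMap.toSpanSingleton (Cx R) A c ∘ₗ counit) :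
        WithConv (H →ₗ[Cx R] A)) g =
        α.act g (star c * x) * c := by
      rw [conv_apply]
      refine (sw_congr (fun p q => ?_) g).trans (sw_counit_right ((LinearMap.mulRight (Cx R) c) ∘ₗ
        (orbit α (star c * x)).ofConv) g)
      simp
    rw [UGroup.isU_hat_aux, mul_assoc, UGroup.cst_mul hc, ← mul_assoc, ← orbit_mul, h, ← hc,
      ← mul_assoc, hu₁, one_mul]

/-- An isometric automorphism of the canonical bimodule is the multiplication by a unitary central
element, the image of `1`. -/
theorem exists_central_of_iso (φ : (Rep.unit (R := R) A).Iso (Rep.unit A)) :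
    ∃ c : UGroup.centralUnitary A, ∀ x, φ.toEquiv (Rep.ofAlg x) = Rep.ofAlg ((c.1 : A) * x) := by
  obtain ⟨c, hc⟩ := Rep.ofAlg.surjective (φ.toEquiv (Rep.ofAlg 1))
  have h₁ : ∀ x, φ.toEquiv (Rep.ofAlg x) = Rep.ofAlg (c * x) := fun x => by
    have h := φ.map_right x (Rep.ofAlg 1)
    rwa [Rep.unit_right, one_mul, ← hc, Rep.unit_right] at h
  have h₂ : ∀ x, c * x = x * c := fun x => by
    have h := φ.map_left x (Rep.ofAlg 1)
    rw [Rep.unit_left, mul_one, ← hc, Rep.unit_left, h₁] at h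
    exact Rep.ofAlg.injective h
  have h₃ : star c * c = 1 := by
    have h := φ.inner_map (Rep.ofAlg 1) (Rep.ofAlg 1)
    rwa [← hc, Rep.unit_inner, Rep.unit_inner, star_one, one_mul] at h
  exact ⟨⟨⟨c, Unitary.mem_iff.2 ⟨h₃, by rw [h₂, h₃]⟩⟩, h₂⟩, h₁⟩

theorem exists_hat_of_equivariant {a : UGroup α} {φ : (Rep.unit (R := R) A).Iso (Rep.unit A)}
    (h : Equivariant (twist a) (unit α) φ) : ∃ c, UGroup.hat α c = a := by
  obtain ⟨c, hc⟩ := exists_central_of_iso φ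
  refine ⟨c⁻¹, Subtype.ext (LinearMap.ext fun g => ?_)⟩
  have h₁ := h g (Rep.ofAlg 1)
  rw [twist_act, hc, hc, orbit_one, mul_one, mul_one, unit_act] at h₁
  have h₂ : (c.1 : A) * a.1 g = α.act g (c.1 : A) := Rep.ofAlg.injective h₁
  rw [UGroup.hat_apply, inv_inv, ← h₂, c.2, mul_assoc]
  exact (congrArg (a.1 g * ·) (Unitary.mem_iff.1 c.1.2).2).trans (mul_one _)

end HAction

end

section

variable {R : Type v} [CommRing R] [LinearOrder R] [IsStrictOrderedRing R]
  {H : Type w} [Ring H] [HopfAlgebra (Cx R) H] [StarRing H] [StarModule (Cx R) H]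
  [IsHopfStar (Cx R) H] {A B C : HStarAlg.{v, w, u} R H}

/-! ### The section of the forgetful map -/

section Momentum

variable {JA : H →⋆ₐ[Cx R] A.alg.carrier} {JB : H →⋆ₐ[Cx R] B.alg.carrier}
  {JC : H →⋆ₐ[Cx R] C.alg.carrier} (hA : IsMomentumMap A.action JA)
  (hB : IsMomentumMap B.action JB) (hC : IsMomentumMap C.action JC)

/-- The class of a bimodule with the action given by the momentum maps. -/
def momentumHom (f : A.alg ⟶ B.alg) : A ⟶ B :=
  Quotient.map (fun E => ⟨E, HAction.momentum hB hA E⟩)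
    (fun _ _ h => Nonempty.elim h fun φ => ⟨φ, HAction.equivariant_momentum hA hB φ⟩) f

theorem momentumHom_id : momentumHom hA hA (𝟙 A.alg) = 𝟙 A :=
  congrArg (fun e => BiModStrH.mk ⟨Rep.unit A.alg.carrier, e⟩) (HAction.momentum_unit hA)

theorem momentumHom_comp (f : A.alg ⟶ B.alg) (g : B.alg ⟶ C.alg) :
    momentumHom hA hC (f ≫ g) = momentumHom hA hB f ≫ momentumHom hB hC g := by
  induction f using Quotient.inductionOn with
  | h E =>
    induction g using Quotient.inductionOn with
    | h F =>
      exact congrArg (fun e => BiModStrH.mk ⟨Rep.tensor F E, e⟩)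
        (HAction.momentum_tensor hA hB hC F E)

theorem forgetH_momentumHom (f : A.alg ⟶ B.alg) :
    (forgetH R H).map (momentumHom hA hB f) = f := by
  induction f using Quotient.inductionOn with
  | h E => rfl

/-- The lift of an arrow of the strong Picard groupoid given by the momentum maps. -/
def momentumIso (f : StrPic B.alg A.alg) : StrPicH B A where
  hom := momentumHom hA hB f.hom
  inv := momentumHom hB hA f.inv
  hom_inv_id := by rw [← momentumHom_comp, f.hom_inv_id, momentumHom_id]
  inv_hom_id := by rw [← momentumHom_comp, f.inv_hom_id, momentumHom_id]

theorem forget_momentumIso (f : StrPic B.alg A.alg) :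
    StrPicH.forget B A (momentumIso hA hB f) = f :=
  Iso.ext (forgetH_momentumHom hA hB f.hom)

/-- The splitting of the forgetful homomorphism of Picard groups. -/
def momentumAut : StrPicGroup A.alg →* StrPicHGroup A where
  toFun := momentumIso hA hA
  map_one' := Iso.ext (momentumHom_id hA)
  map_mul' f g := Iso.ext (momentumHom_comp hA hA hA g.hom f.hom)

end Momentum

/-! ### The kernel of the forgetful homomorphism -/

/-- Twisting the action on the canonical bimodule, as a homomorphism to the endomorphisms of `A` in
the covariant category. -/
def twistEnd (A : HStarAlg.{v, w, u} R H) : UGroup A.action →* End A where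
  toFun a := BiModStrH.mk ⟨Rep.unit A.alg.carrier, HAction.twist a⟩
  map_one' := congrArg (fun e => BiModStrH.mk ⟨Rep.unit A.alg.carrier, e⟩) HAction.twist_one
  map_mul' a b := (Quotient.sound (HAction.exists_twist_tensor a b)).symm

/-- Twisting the action on the canonical bimodule, as a homomorphism to the Picard group. -/
def twistAut (A : HStarAlg.{v, w, u} R H) : UGroup A.action →* StrPicHGroup A :=
  (Aut.unitsEndEquivAut A).toMonoidHom.comp (twistEnd A).toHomUnits

theorem twistAut_hom (a : UGroup A.action) : (twistAut A a).hom =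
    BiModStrH.mk ⟨Rep.unit A.alg.carrier, HAction.twist a⟩ := rfl

theorem ker_twistAut : (twistAut A).ker = (UGroup.hat A.action).range := by
  ext a
  rw [MonoidHom.mem_ker, MonoidHom.mem_range]
  constructor
  · intro h
    obtain ⟨φ, hφ⟩ : HRep.Iso ⟨Rep.unit A.alg.carrier, HAction.twist a⟩ (HRep.unit A) :=
      Quotient.exact (congrArg Iso.hom h)
    exact HAction.exists_hat_of_equivariant hφ
  · rintro ⟨c, rfl⟩
    exact Iso.ext (Quotient.sound (HAction.exists_twist_hat c))

theorem range_twistAut : (twistAut A).range = (StrPicHGroup.forget A).ker := by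
  ext p
  rw [MonoidHom.mem_ker, MonoidHom.mem_range]
  constructor
  · rintro ⟨a, rfl⟩
    exact Iso.ext rfl
  · intro h
    obtain ⟨E, hE⟩ := Quotient.exists_rep p.hom
    have h₁ : (forgetH R H).map p.hom = 𝟙 A.alg := congrArg Iso.hom h
    rw [← hE] at h₁
    obtain ⟨φ⟩ : Nonempty (E.rep.Iso (Rep.unit A.alg.carrier)) := Quotient.exact h₁
    obtain ⟨a, ha⟩ := HAction.exists_eq_twist (E.action.transport φ)
    refine ⟨a, Iso.ext ?_⟩
    rw [twistAut_hom, ← ha, ← hE]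
    exact (Quotient.sound (s := HRep.setoid A A) (a := E) (b := ⟨_, E.action.transport φ⟩)
      ⟨φ, HAction.equivariant_transport E.action φ⟩).symm

/-- The first map of the exact sequence. -/
def uZeroHom (A : HStarAlg.{v, w, u} R H) : UZero A.action →* StrPicHGroup A :=
  QuotientGroup.lift _ (twistAut A) ker_twistAut.ge

theorem uZeroHom_injective : Function.Injective (uZeroHom A) :=
  (QuotientGroup.injective_lift_iff _ _ _).2 ker_twistAut.symm

theorem range_uZeroHom : (uZeroHom A).range = (StrPicHGroup.forget A).ker := by
  rw [← range_twistAut]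
  ext p
  exact (QuotientGroup.mk_surjective (s := (UGroup.hat A.action).range)).exists

end

end StrongPicard

end

theorem mainTheorem2 {R : Type v} [CommRing R] [LinearOrder R] [IsStrictOrderedRing R]
    {H : Type w} [Ring H] [HopfAlgebra (StrongPicard.Cx R) H] [StarRing H]
    [StarModule (StrongPicard.Cx R) H] [StrongPicard.IsHopfStar (StrongPicard.Cx R) H]
    (A B : StrongPicard.HStarAlg.{v, w, u} R H)
    (JA : H →⋆ₐ[StrongPicard.Cx R] A.alg.carrier)
    (hJA : StrongPicard.IsMomentumMap A.action JA)
    (JB : H →⋆ₐ[StrongPicard.Cx R] B.alg.carrier)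
    (hJB : StrongPicard.IsMomentumMap B.action JB)
    (hne : Nonempty (StrongPicard.StrPic B.alg A.alg)) :
    Function.Surjective (StrongPicard.StrPicH.forget B A) ∧
    ∃ (ι : StrongPicard.UZero A.action →* StrongPicard.StrPicHGroup A)
      (σ : StrongPicard.StrPicGroup A.alg →* StrongPicard.StrPicHGroup A),
      (∀ a : StrongPicard.UGroup A.action,
        ∃ e : StrongPicard.HAction A.action A.action
            (StrongPicard.Rep.unit (R := R) A.alg.carrier),
          StrongPicard.IsTwist a.1 e ∧
          (ι (QuotientGroup.mk a)).hom =
            StrongPicard.BiModStrH.mk ⟨StrongPicard.Rep.unit A.alg.carrier, e⟩) ∧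
      Function.Injective ι ∧
      ι.range = (StrongPicard.StrPicHGroup.forget A).ker ∧
      Function.Surjective (StrongPicard.StrPicHGroup.forget A) ∧
      (StrongPicard.StrPicHGroup.forget A).comp σ = MonoidHom.id _ ∧
      (∀ (p : StrongPicard.StrPicGroup A.alg)
        (E : StrongPicard.Rep R A.alg.carrier A.alg.carrier), p.hom = StrongPicard.BiModStr.mk E →
        ∃ e : StrongPicard.HAction A.action A.action E,
          StrongPicard.IsMomentumLift JA JA e ∧
          (σ p).hom = StrongPicard.BiModStrH.mk ⟨E, e⟩) := by
  refine ⟨fun f => ⟨StrongPicard.momentumIso hJA hJB f, StrongPicard.forget_momentumIso hJA hJB f⟩,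
    StrongPicard.uZeroHom A, StrongPicard.momentumAut hJA, fun a => ⟨StrongPicard.HAction.twist a,
      fun g x => ?_, rfl⟩, StrongPicard.uZeroHom_injective, StrongPicard.range_uZeroHom,
    fun f => ⟨StrongPicard.momentumIso hJA hJA f, StrongPicard.forget_momentumIso hJA hJA f⟩,
    MonoidHom.ext (StrongPicard.forget_momentumIso hJA hJA), fun p E h =>
      ⟨StrongPicard.HAction.momentum hJA hJA E, StrongPicard.Rep.momentumAct_apply JA JA E, ?_⟩⟩
  · rw [StrongPicard.HAction.twist_act, StrongPicard.conv_apply]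
    rfl
  · exact congrArg (StrongPicard.momentumHom hJA hJA) h
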